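/- Let $\mathbb{T}^1=\mathbb{R}/\mathbb{Z}$, $\mathbb{T}^2=\mathbb{T}^1\times\mathbb{T}^1$ and $p_1(\theta,x)=\theta$. A \emph{qpf circle homeomorphism} over $\omega\in\mathbb{R}\setminus\mathbb{Q}$ is a homeomorphism of $\mathbb{T}^2$ of the form $(\theta,x)\mapsto(\theta+\omega,f_\theta(x))$ that is isotopic to the identity. A map $g:\mathbb{T}^1\to\mathbb{T}^1$ is \emph{increasing} if it has a continuous non-decreasing lift $G:\mathbb{R}\to\mathbb{R}$ with $G(t+1)=G(t)+1$. A homeomorphism $f$ of $\mathbb{T}^2$ is \emph{transitive} if for all non-empty open $U,V\subseteq\mathbb{T}^2$ there is $n\ge 0$ with $f^n(U)\cap V\neq\emptyset$. An interval is \emph{non-trivial} if it has more than one point. Two graphs $\Gamma,\Gamma'$ of continuous maps $\mathbb{T}^1\to\mathbb{T}^1$ \emph{have flat intersections} if $p_1(\Gamma\cap\Gamma')$ is a finite (possibly empty) union of disjoint non-trivial intervals. They \emph{cross over} a set $I\subseteq\mathbb{T}^1$ if there are an interval $I'\subseteq I$ and an open interval $O\subsetneq\mathbb{T}^1$ such that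 $\Gamma\cap(I'\times\mathbb{T}^1)$ and $\Gamma'\cap(I'\times\mathbb{T}^1)$ are contained in $I'\times O$ and $\Gamma'\cap(I'\times\mathbb{T}^1)$ meets both connected components of $(I'\times O)\setminus\Gamma$. Let $R$ be a qpf circle homeomorphism over $\omega$, and let $\Gamma$ be the graph of a continuous map $\mathbb{T}^1\to\mathbb{T}^1$ that has flat intersections with $R^n(\Gamma)$ for every $n\in\mathbb{Z}$. Put $\Xi=\bigcup_{n\in\mathbb{Z}}R^n(\Gamma)$. Then there exist a continuous onto map $\pi:\mathbb{T}^2\to\mathbb{T}^2$, $(\theta,x)\mapsto(\theta,\pi_\theta(x))$, and a qpf circle homeomorphism $f:(\theta,x)\mapsto(\theta+\omega,f_\theta(x))$ over the same $\omega$ such that: (i) for all $\theta\in\mathbb{T}^1$ the map $\pi_\theta$ is increasing; (ii) if $(\theta,x)\in\Xi$, then $\pi^{-1}(\theta,x)$ is a non-trivial interval in the circle $\{\theta\}\times\mathbb{T}^1$; (iii) if $(\theta,x)\notin\Xi$, then $\pi^{-1}(\theta,x)$ is a single point; (iv) $\pi\circ f=R\circ\pi$; (v) $\pi^{-1}(\Xi)$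 has non-empty interior. Moreover, suppose that $R$ is transitive, that $\Xi$ is dense in $\mathbb{T}^2$, and that $\Gamma$ has the crossing property (T) for all non-trivial intervals $I,J\subseteq\mathbb{T}^1$ there is some $n\ge 0$ such that $\Gamma$ and $R^n(\Gamma)$ cross over $I\cap(J+n\omega)$. Then, for any such $\pi$ and $f$ satisfying (i)--(v), $f$ is transitive. -/

import Mathlib

namespace QPF

/-- The circle `ℝ / ℤ`. -/
abbrev T1 : Type := UnitAddCircle

/-- The two-torus; the first coordinate is the base variable, the second the fibre variable. -/
abbrev T2 : Type := T1 × T1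

/-- `g` is isotopic to the identity: it is joined to it by a path of homeomorphisms. -/
def IsotopicToId (g : T2 ≃ₜ T2) : Prop :=
  ∃ H : unitInterval × T2 → T2, Continuous H ∧ (∀ t, IsHomeomorph (fun z => H (t, z))) ∧
    (∀ z, H (0, z) = z) ∧ (∀ z, H (1, z) = g z)

/-- Quasi-periodically forced circle homeomorphism with base rotation number `ω`: a homeomorphism
of the torus of the form `(θ, x) ↦ (θ + ω, f_θ x)`, `ω` irrational, isotopic to the identity. -/
def IsQpf (ω : ℝ) (f : T2 ≃ₜ T2) : Prop :=
  Irrational ω ∧ (∀ θ x : T1, (f (θ, x)).1 = θ + (ω : T1)) ∧ IsotopicToId f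

/-- Non-trivial intervals of the circle: images of intervals of `ℝ` with more than one point. -/
def IsNontrivialInterval (I : Set T1) : Prop :=
  ∃ J : Set ℝ, J.OrdConnected ∧ J.Nontrivial ∧ I = (fun t : ℝ => (t : T1)) '' J

/-- A circle map is increasing (in the weak sense) if it has a continuous monotone lift `F` with
`F (t + 1) = F t + 1`. -/
def IsIncreasing (g : T1 → T1) : Prop :=
  ∃ F : ℝ → ℝ, Continuous F ∧ Monotone F ∧ (∀ t, F (t + 1) = F t + 1) ∧
    ∀ t : ℝ, g (t : T1) = (F t : T1)

/-- The graph of a circle map, as a subset of the torus. -/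
def graph (γ : T1 → T1) : Set T2 := {z | z.2 = γ z.1}

/-- The iterate `R ^ n (Γ)`, for `n ∈ ℤ`. -/
def iter (R : T2 ≃ₜ T2) (n : ℤ) (Γ : Set T2) : Set T2 := (fun z => (R ^ n) z) '' Γ

/-- `p₁ (Γ ∩ Γ')` is a finite union of disjoint non-trivial intervals. -/
def FlatIntersections (Γ Γ' : Set T2) : Prop :=
  ∃ S : Set (Set T1), S.Finite ∧ S.PairwiseDisjoint id ∧ (∀ I ∈ S, IsNontrivialInterval I) ∧
    Prod.fst '' (Γ ∩ Γ') = ⋃₀ S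

/-- `Γ` and `Γ'` cross over `I`: for some interval `I' ⊆ I` and some open interval `O ≠ T1`, both
graphs restricted to `I'` lie in `I' × O`, and `Γ'` meets every connected component (there are
two of them) of `(I' × O) \ Γ`. -/
def CrossOver (Γ Γ' : Set T2) (I : Set T1) : Prop :=
  ∃ I' O : Set T1, I' ⊆ I ∧ IsNontrivialInterval I' ∧
    IsNontrivialInterval O ∧ IsOpen O ∧ O ≠ Set.univ ∧
    Γ ∩ Prod.fst ⁻¹' I' ⊆ I' ×ˢ O ∧ Γ' ∩ Prod.fst ⁻¹' I' ⊆ I' ×ˢ O ∧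
    ∀ z ∈ (I' ×ˢ O) \ Γ, (connectedComponentIn ((I' ×ˢ O) \ Γ) z ∩ Γ').Nonempty

/-- The crossing property: for all non-trivial intervals `I`, `J` there is `n ≥ 0` such that `Γ`
and `R ^ n (Γ)` cross over `I ∩ (J + n ω)`. -/
def CrossingProperty (ω : ℝ) (R : T2 ≃ₜ T2) (Γ : Set T2) : Prop :=
  ∀ I J : Set T1, IsNontrivialInterval I → IsNontrivialInterval J →
    ∃ n : ℕ, CrossOver Γ (iter R n Γ) (I ∩ (fun θ : T1 => θ + n • (ω : T1)) '' J)

/-- Topological transitivity. -/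
def IsTransitive (f : T2 ≃ₜ T2) : Prop :=
  ∀ U V : Set T2, IsOpen U → IsOpen V → U.Nonempty → V.Nonempty →
    ∃ n : ℕ, ((f^[n] '' U) ∩ V).Nonempty

/-- The union `Ξ` of all iterates of `Γ`. -/
def orbitUnion (R : T2 ≃ₜ T2) (Γ : Set T2) : Set T2 := ⋃ n : ℤ, iter R n Γ

/-- `f` is a qpf circle homeomorphism over the rotation by `ω` which is an extension of `R`, via
the fibre-respecting map `π`, obtained by blowing up exactly the points of `Ξ`. -/
structure IsBlowUp (ω : ℝ) (R : T2 ≃ₜ T2) (Ξ : Set T2) (π : T2 → T2) (f : T2 ≃ₜ T2) : Prop where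
  continuous : Continuous π
  surjective : Function.Surjective π
  fibre : ∀ θ x : T1, (π (θ, x)).1 = θ
  qpf : IsQpf ω f
  increasing : ∀ θ : T1, IsIncreasing (fun x => (π (θ, x)).2)
  interval : ∀ θ x : T1, (θ, x) ∈ Ξ →
    ∃ A : Set T1, IsNontrivialInterval A ∧ π ⁻¹' {(θ, x)} = {θ} ×ˢ A
  point : ∀ θ x : T1, (θ, x) ∉ Ξ → ∃ w : T2, π ⁻¹' {(θ, x)} = {w}
  semiconj : ∀ z, π (f z) = R (π z)
  interior : (interior (π ⁻¹' Ξ)).Nonempty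

end QPF

/-! Write $c_n$ for the map whose graph is $R^n(\Gamma)$ (`curve`), choose weights $a_n>0$ with sum
$A<1$, and add up the saw-teeth $a_n\,\mathrm{fr}(x-c_n(\theta))$. Each tooth climbs at unit slope
and drops by one at $c_n(\theta)$, so $x$ minus the sum is strictly increasing on fibres and jumps
upward exactly on $\Xi$. Filling in the jumps gives a compact set of triples $(\theta,x,s)$
(`IsHeight`), which $(\theta,x,s)\mapsto(\theta,x-s)$ maps homeomorphically onto the torus
(`exists_height_function`). Read on triples, $\pi$ forgets $s$. Its fibre over a point is an arc
whose length is the total weight of the curves through that point.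

To lift $R$, a triple over $(\theta,x)$ needs a height over $R(\theta,x)$ that depends continuously
on the triple and is strictly increasing in $s$ inside a gap. The tooth of $c_n$ is carried to the
tooth of $c_{n+1}$, its jump replaced by a continuous step in $s$ between two heights `lowSum` and
`uppSum`. The difficulty is that several curves may share a gap. Flatness makes the zeros of
$c_n-c_m$ one-sided, so this difference lifts continuously to $[0,1]$ (`lowerLift`). At an end of an
intersection interval adjoining points where $c_n\ne c_m$, the lifts stack the two steps in the
order of the curves there; in between the steps may overlap. Injectivity of $f$ requires that the
steps leave no subinterval of a gap uncovered (`exists_lowSum_lt`). This is a finite combinatorial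
fact: the relations "pushed down by" between curves through one point have no obstructing cycle
(`exists_sink`).

For transitivity, Baire's theorem, density of $\Xi$ and the crossing property put into every open
set an open piece of the gaps of a single curve. After applying powers of $f$, two such pieces lie
over $\Gamma$ and contain horizontal segments. If $\Gamma$ and $R^n(\Gamma)$ cross over the relevant
base interval, the $f^n$-image of one segment must meet the other (`exists_section_eq`): otherwise
the image would stay on one side of it, and the monotone maps $\pi_\theta$ would preserve this
order. -/

namespace QPF

open Set Filter Topology

/-! ### Fractional parts on the circle -/

/-- The representative of a point of the circle in `[0, 1)`. -/
noncomputable def fr (z : T1) : ℝ := (AddCircle.equivIco (1 : ℝ) 0 z : ℝ)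

lemma fr_coe (t : ℝ) : fr (t : T1) = Int.fract t := by
  simp [fr, AddCircle.coe_equivIco_mk_apply]

lemma coe_fr (z : T1) : ((fr z : ℝ) : T1) = z := AddCircle.coe_equivIco

lemma fr_nonneg (z : T1) : 0 ≤ fr z := (AddCircle.equivIco (1 : ℝ) 0 z).2.1

lemma fr_lt_one (z : T1) : fr z < 1 :=
  (AddCircle.equivIco (1 : ℝ) 0 z).2.2.trans_eq (zero_add 1)

lemma fr_of_mem {t : ℝ} (h0 : 0 ≤ t) (h1 : t < 1) : fr (t : T1) = t := by
  rw [fr_coe, Int.fract_eq_self.2 ⟨h0, h1⟩]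

lemma fr_zero : fr 0 = 0 := by
  simpa using fr_of_mem (t := 0) le_rfl one_pos

lemma fr_eq_zero {z : T1} : fr z = 0 ↔ z = 0 := by
  refine ⟨fun h => ?_, fun h => h ▸ fr_zero⟩
  rw [← coe_fr z, h]; simp

lemma fr_pos {z : T1} : 0 < fr z ↔ z ≠ 0 := by
  rw [(fr_nonneg z).lt_iff_ne, ne_comm, Ne, fr_eq_zero]

lemma coe_one : ((1 : ℝ) : T1) = 0 := AddCircle.coe_period 1

lemma coe_eq_zero_iff_int {t : ℝ} : (t : T1) = 0 ↔ ∃ n : ℤ, (n : ℝ) = t := by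
  rw [AddCircle.coe_eq_zero_iff]; simp

lemma coe_eq_coe_iff_int {s t : ℝ} : (s : T1) = (t : T1) ↔ ∃ n : ℤ, s = t + n := by
  rw [← sub_eq_zero, ← AddCircle.coe_sub, coe_eq_zero_iff_int]
  exact exists_congr fun n => ⟨fun h => by linarith, fun h => by linarith⟩

lemma coe_int (n : ℤ) : ((n : ℝ) : T1) = 0 := coe_eq_zero_iff_int.2 ⟨n, rfl⟩

lemma fr_neg {z : T1} (hz : z ≠ 0) : fr (-z) = 1 - fr z := by
  have h : ((1 - fr z : ℝ) : T1) = -z := by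
    rw [AddCircle.coe_sub, coe_fr, coe_one, zero_sub]
  rw [← h]
  have := fr_pos.2 hz
  exact fr_of_mem (by linarith [fr_lt_one z]) (by linarith)

lemma fr_add_fr_neg_le (z : T1) : fr z + fr (-z) ≤ 1 := by
  rcases eq_or_ne z 0 with rfl | h
  · simp [fr_zero]
  · rw [fr_neg h]; linarith

lemma fr_add_of_lt {z w : T1} (h : fr z + fr w < 1) : fr (z + w) = fr z + fr w := by
  rw [← coe_fr z, ← coe_fr w, ← AddCircle.coe_add, coe_fr, coe_fr]
  exact fr_of_mem (add_nonneg (fr_nonneg z) (fr_nonneg w)) h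

/-- The upper representative in `(0, 1]` grows at most at unit speed from the lower one. -/
lemma one_sub_fr_neg_add_le (z : T1) {e : ℝ} (he : 0 < e) :
    1 - fr (-(z + (e : T1))) ≤ fr z + e := by
  by_cases h : fr z + e < 1
  · have h1 : fr (z + (e : T1)) = fr z + e := by
      have h2 : fr (e : T1) = e := fr_of_mem he.le (by linarith [fr_nonneg z])
      rw [fr_add_of_lt (by rw [h2]; exact h), h2]
    have h3 : z + (e : T1) ≠ 0 := by
      rw [← fr_pos, h1]; linarith [fr_nonneg z]
    rw [fr_neg h3, h1]; linarith
  · linarith [fr_nonneg (-(z + (e : T1)))]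

lemma norm_eq_min_fr (z : T1) : ‖z‖ = min (fr z) (1 - fr z) := by
  conv_lhs => rw [← coe_fr z]
  rw [UnitAddCircle.norm_eq, abs_sub_round_eq_min,
    Int.fract_eq_self.2 ⟨fr_nonneg z, fr_lt_one z⟩]

lemma norm_coe_le (t : ℝ) : ‖(t : T1)‖ ≤ |t| := by
  rw [UnitAddCircle.norm_eq]
  simpa using round_le t 0

lemma exists_coe_eq_abs_eq_norm (z : T1) : ∃ t : ℝ, (t : T1) = z ∧ |t| = ‖z‖ := by
  rw [norm_eq_min_fr]
  rcases le_total (fr z) (1 - fr z) with h | h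
  · exact ⟨fr z, coe_fr z, by rw [min_eq_left h, abs_of_nonneg (fr_nonneg z)]⟩
  · refine ⟨fr z - 1, by rw [AddCircle.coe_sub, coe_fr, coe_one, sub_zero], ?_⟩
    rw [min_eq_right h, abs_of_nonpos (by linarith [fr_lt_one z])]; ring

lemma continuousAt_fr {z : T1} (hz : z ≠ 0) : ContinuousAt fr z :=
  continuous_subtype_val.continuousAt.comp
    (AddCircle.continuousAt_equivIco (1 : ℝ) 0 (by simpa using hz))

lemma lowerSemicontinuous_fr : LowerSemicontinuous fr := by
  intro z
  rcases eq_or_ne z 0 with rfl | h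
  · intro y hy
    rw [fr_zero] at hy
    exact Eventually.of_forall fun w => hy.trans_le (fr_nonneg w)
  · exact (continuousAt_fr h).lowerSemicontinuousAt

/-! ### Weighted sums of bounded functions -/

/-- Summable positive weights indexed by the integers. -/
structure IsWeight (a : ℤ → ℝ) : Prop where
  pos : ∀ n, 0 < a n
  summable : Summable a
  lt_one : ∑' n, a n < 1

lemma exists_isWeight : ∃ a : ℤ → ℝ, IsWeight a := by
  obtain ⟨a, ha, c, hc, hc'⟩ := posSumOfEncodable (ε := 1 / 2) (by norm_num) ℤ
  exact ⟨a, ha, hc.summable, by rw [hc.tsum_eq]; linarith⟩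

namespace IsWeight

variable {a : ℤ → ℝ} (ha : IsWeight a)
include ha

lemma summable_mul {g : ℤ → ℝ} (h0 : ∀ n, 0 ≤ g n) (h1 : ∀ n, g n ≤ 1) :
    Summable fun n => a n * g n :=
  Summable.of_nonneg_of_le (fun n => mul_nonneg (ha.pos n).le (h0 n))
    (fun n => mul_le_of_le_one_right (ha.pos n).le (h1 n)) ha.summable

lemma shift : IsWeight fun n => a (n + 1) where
  pos n := ha.pos _
  summable := (Equiv.addRight (1 : ℤ)).summable_iff.2 ha.summable
  lt_one := by
    have := (Equiv.addRight (1 : ℤ)).tsum_eq a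
    simp only [Equiv.coe_addRight] at this
    rw [this]; exact ha.lt_one

lemma continuous_tsum {X : Type*} [TopologicalSpace X] {g : ℤ → X → ℝ} {C : ℝ}
    (hg : ∀ n, Continuous (g n)) (h : ∀ n x, |g n x| ≤ C) :
    Continuous fun x => ∑' n, a n * g n x :=
  _root_.continuous_tsum (fun n => continuous_const.mul (hg n)) (ha.summable.mul_right C)
    fun n x => by
      rw [Real.norm_eq_abs, abs_mul, abs_of_pos (ha.pos n)]
      exact mul_le_mul_of_nonneg_left (h n x) (ha.pos n).le

/-- Finite partial sums are lower semicontinuous, and a sum of nonnegative terms is bounded by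
$\tau$ exactly when all its partial sums are. -/
lemma isClosed_tsum_fr_le {X : Type*} [TopologicalSpace X] {g : ℤ → X → T1} {τ : X → ℝ}
    (hg : ∀ n, Continuous (g n)) (hτ : Continuous τ) :
    IsClosed {x | ∑' n, a n * fr (g n x) ≤ τ x} := by
  have hs : ∀ x, Summable fun n => a n * fr (g n x) := fun x =>
    ha.summable_mul (fun n => fr_nonneg _) fun n => (fr_lt_one _).le
  have : {x | ∑' n, a n * fr (g n x) ≤ τ x} =
      ⋂ F : Finset ℤ, {x | ∑ n ∈ F, a n * fr (g n x) + (- τ x) ≤ 0} := by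
    ext x
    simp only [mem_ofPred_eq, mem_iInter]
    constructor
    · intro h F
      have := (hs x).sum_le_tsum F fun n _ => mul_nonneg (ha.pos n).le (fr_nonneg (g n x))
      linarith
    · intro h
      refine (hs x).tsum_le_of_sum_le fun F => ?_
      linarith [h F]
  rw [this]
  refine isClosed_iInter fun F => ?_
  have hl : LowerSemicontinuous fun x => ∑ n ∈ F, a n * fr (g n x) + (- τ x) := by
    refine LowerSemicontinuous.add ?_ hτ.neg.lowerSemicontinuous
    refine lowerSemicontinuous_sum fun n _ => ?_
    exact (continuous_const.mul continuous_id).comp_lowerSemicontinuous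
      (lowerSemicontinuous_fr.comp (hg n))
      (fun x y h => mul_le_mul_of_nonneg_left h (ha.pos n).le)
  exact hl.isClosed_preimage 0

end IsWeight

/-! ### Lifting displacements to the real line -/

lemma exists_real_lift {X : Type*} [TopologicalSpace X] {g : unitInterval × X → T1}
    (hg : Continuous g) (h0 : ∀ x, g (0, x) = 0) :
    ∃ G : unitInterval × X → ℝ, Continuous G ∧ (∀ p, (G p : T1) = g p) ∧ ∀ x, G (0, x) = 0 := by
  have cov : IsCoveringMap ((↑) : ℝ → T1) := AddCircle.isCoveringMap_coe (1 : ℝ)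
  have H0 : ∀ x, (⟨g, hg⟩ : C(unitInterval × X, T1)) (0, x)
      = ((0 : C(X, ℝ)) x : T1) := fun x => by simp [h0]
  refine ⟨cov.liftHomotopy ⟨g, hg⟩ 0 H0, map_continuous _, fun p => ?_, fun x => ?_⟩
  · exact congrFun (cov.liftHomotopy_lifts ⟨g, hg⟩ 0 H0) p
  · exact cov.liftHomotopy_zero ⟨g, hg⟩ 0 H0 x

/-- A continuous function on the torus which displaces fibres in a strictly monotone way. -/
structure IsDisplacement (φ : T2 → ℝ) : Prop where
  continuous : Continuous φ
  strictMono : ∀ θ : T1, StrictMono fun x : ℝ => x + φ (θ, (x : T1))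

namespace IsDisplacement

variable {φ : T2 → ℝ} (h : IsDisplacement φ)
include h

/-- On each fibre the lift is strictly increasing, commutes with integer translations and differs
from the identity by a bounded amount, hence is onto. Compactness of the torus makes the continuous
bijection a homeomorphism. -/
lemma isHomeomorph (c : T1) :
    IsHomeomorph fun z : T2 => ((z.1 + c, z.2 + (φ z : T1)) : T2) := by
  have hc : Continuous fun z : T2 => ((z.1 + c, z.2 + (φ z : T1)) : T2) := by
    have := h.continuous
    have h2 : Continuous fun z => (φ z : T1) := (AddCircle.continuous_mk' 1).comp this
    fun_prop
  rw [isHomeomorph_iff_continuous_bijective]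
  refine ⟨hc, ?_, ?_⟩
  · rintro ⟨θ, y⟩ ⟨θ', y'⟩ he
    simp only [Prod.mk.injEq, add_left_inj] at he
    obtain ⟨rfl, he⟩ := he
    induction y using QuotientAddGroup.induction_on with | _ s
    induction y' using QuotientAddGroup.induction_on with | _ t
    change (s : T1) + (φ (θ, (s : T1)) : T1) = (t : T1) + (φ (θ, (t : T1)) : T1) at he
    rw [← AddCircle.coe_add, ← AddCircle.coe_add, coe_eq_coe_iff_int] at he
    obtain ⟨k, hk⟩ := he
    have ht : ((t + k : ℝ) : T1) = t := by rw [AddCircle.coe_add, coe_int, add_zero]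
    have := (h.strictMono θ).injective (a₁ := s) (a₂ := t + k) (by simp only [ht]; linarith)
    change ((θ, (s : T1)) : T2) = (θ, (t : T1))
    rw [this, ht]
  · rintro ⟨θ, y⟩
    obtain ⟨C, hC⟩ := isCompact_univ.exists_bound_of_continuousOn h.continuous.continuousOn
    have hcont : Continuous fun x : ℝ => x + φ (θ - c, (x : T1)) := by
      have h1 := h.continuous
      have h2 : Continuous fun x : ℝ => (x : T1) := AddCircle.continuous_mk' 1
      fun_prop
    have hb : ∀ x : ℝ, |φ (θ - c, (x : T1))| ≤ C := fun x => hC _ (mem_univ _)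
    have htop : Tendsto (fun x : ℝ => x + φ (θ - c, (x : T1))) atTop atTop :=
      tendsto_atTop_mono (fun x => by have := neg_le_of_abs_le (hb x); simp only [id]; linarith)
        (tendsto_atTop_add_const_right _ (-C) tendsto_id)
    have hbot : Tendsto (fun x : ℝ => x + φ (θ - c, (x : T1))) atBot atBot :=
      tendsto_atBot_mono (fun x => by have := le_of_abs_le (hb x); simp only [id]; linarith)
        (tendsto_atBot_add_const_right _ C tendsto_id)
    obtain ⟨x, hx⟩ := hcont.surjective htop hbot (fr y)
    refine ⟨(θ - c, (x : T1)), ?_⟩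
    simp only [sub_add_cancel, Prod.mk.injEq, true_and]
    rw [← AddCircle.coe_add]
    simp only at hx
    rw [hx, coe_fr]

/-- The new lift is a convex combination of the identity and the old lift. This supplies the isotopy
to the identity. -/
lemma smul {t : ℝ} (h0 : 0 ≤ t) (h1 : t ≤ 1) : IsDisplacement fun z => t * φ z where
  continuous := continuous_const.mul h.continuous
  strictMono θ x y hxy := by
    have := h.strictMono θ hxy
    simp only at this ⊢
    rcases h0.eq_or_lt with rfl | h0
    · simpa using hxy
    · nlinarith

lemma exists_isQpf {ω : ℝ} (hω : Irrational ω) :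
    ∃ f : T2 ≃ₜ T2, IsQpf ω f ∧ ∀ z, f z = (z.1 + (ω : T1), z.2 + (φ z : T1)) := by
  refine ⟨(h.isHomeomorph (ω : T1)).homeomorph, ⟨hω, fun θ x => rfl, ?_⟩, fun z => rfl⟩
  refine ⟨fun p => (p.2.1 + (((p.1 : ℝ) * ω : ℝ) : T1), p.2.2 + (((p.1 : ℝ) * φ p.2 : ℝ) : T1)),
    ?_, fun t => ?_, fun z => ?_, fun z => ?_⟩
  · have h1 := h.continuous
    have h2 : Continuous fun x : ℝ => (x : T1) := AddCircle.continuous_mk' 1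
    fun_prop
  · exact (h.smul t.2.1 t.2.2).isHomeomorph (((t : ℝ) * ω : ℝ) : T1)
  · simp
  · simp only [Set.Icc.coe_one, one_mul]
    rfl

/-- A strictly monotone lift of degree one carries an arc of length in $[0,1)$ to an arc of length
in $[0,1)$, so no integer correction appears. -/
lemma fr_add_coe (θ : T1) (x y : T1) :
    fr (x + (φ (θ, x) : T1) - (y + (φ (θ, y) : T1))) = fr (x - y) + φ (θ, x) - φ (θ, y) := by
  obtain ⟨e, he⟩ : ∃ e, e = fr (x - y) := ⟨_, rfl⟩
  have hx : x = ((fr y + e : ℝ) : T1) := by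
    rw [AddCircle.coe_add, he, coe_fr, coe_fr]; abel
  have hm := (h.strictMono θ).monotone
  have h1 := hm (show fr y ≤ fr y + e by rw [he]; linarith [fr_nonneg (x - y)])
  have h2 := h.strictMono θ (show fr y + e < fr y + 1 by rw [he]; linarith [fr_lt_one (x - y)])
  simp only [← hx, coe_fr, AddCircle.coe_add, coe_one, add_zero] at h1 h2
  have h3 : x + (φ (θ, x) : T1) - (y + (φ (θ, y) : T1)) = ((e + φ (θ, x) - φ (θ, y) : ℝ) : T1) := by
    rw [AddCircle.coe_sub, AddCircle.coe_add, he, coe_fr]; abel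
  rw [h3, ← he]
  exact fr_of_mem (by linarith) (by linarith)

end IsDisplacement

lemma IsQpf.exists_displacement {ω : ℝ} {R : T2 ≃ₜ T2} (hR : IsQpf ω R) :
    ∃ ψ : T2 → ℝ, IsDisplacement ψ ∧ ∀ z, R z = (z.1 + (ω : T1), z.2 + (ψ z : T1)) := by
  obtain ⟨-, hfst, H, hH, -, H0, H1⟩ := hR
  obtain ⟨G, hG, hGl, hG0⟩ := exists_real_lift (g := fun p => (H p).2 - p.2.2)
    (by fun_prop) (fun z => by simp [H0])
  have hRz : ∀ z, R z = (z.1 + (ω : T1), z.2 + (G (1, z) : T1)) := fun z =>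
    Prod.ext (hfst z.1 z.2) (by simp [hGl, H1])
  refine ⟨fun z => G (1, z), ⟨by fun_prop, fun θ => ?_⟩, hRz⟩
  have hcont : Continuous fun x : ℝ => x + G (1, (θ, (x : T1))) := by
    have h2 : Continuous fun x : ℝ => (x : T1) := AddCircle.continuous_mk' 1
    fun_prop
  have hinj : Function.Injective fun x : ℝ => x + G (1, (θ, (x : T1))) := by
    intro s t hst
    simp only at hst
    have h1 : R (θ, (s : T1)) = R (θ, (t : T1)) := by
      rw [hRz, hRz]
      simp only [← AddCircle.coe_add, hst]
    have h2 : (s : T1) = t := congrArg Prod.snd (R.injective h1)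
    rw [h2] at hst
    linarith
  rcases hcont.strictMono_of_inj hinj with hm | hm
  · exact hm
  -- The displacement is the same at 0 and 1, so the lift gains exactly one over a period and cannot
  -- decrease.
  · have := hm (show (0 : ℝ) < 1 by norm_num)
    simp only [coe_one, AddCircle.coe_zero] at this
    linarith

/-! ### Monotone lifts through the end-point identification `[0, 1] → T1` -/

/-- The distance to a subset of the circle, truncated at `1`; it is `1` for the empty set. -/
noncomputable def distTo (A : Set T1) (θ : T1) : ℝ := (min (Metric.infEDist θ A) 1).toReal

lemma distTo_nonneg (A : Set T1) (θ : T1) : 0 ≤ distTo A θ := ENNReal.toReal_nonneg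

lemma continuous_distTo (A : Set T1) : Continuous (distTo A) := by
  refine ENNReal.continuousOn_toReal.comp_continuous
    (Metric.continuous_infEDist.min continuous_const) fun θ => ?_
  simp

lemma distTo_pos {A : Set T1} {θ : T1} (h : θ ∉ closure A) : 0 < distTo A θ := by
  refine ENNReal.toReal_pos ?_ ((min_le_right _ _).trans_lt ENNReal.one_lt_top).ne
  rw [Metric.mem_closure_iff_infEDist_zero] at h
  exact (lt_min (pos_iff_ne_zero.2 h) one_pos).ne'

lemma distTo_eq_zero {A : Set T1} {θ : T1} (h : θ ∈ closure A) : distTo A θ = 0 := by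
  rw [Metric.mem_closure_iff_infEDist_zero] at h
  simp [distTo, h]

lemma distTo_le_one (A : Set T1) (θ : T1) : distTo A θ ≤ 1 := by
  have := ENNReal.toReal_mono ENNReal.one_ne_top (min_le_right (Metric.infEDist θ A) 1)
  simpa [distTo] using this

lemma distTo_le_dist {A : Set T1} {θ s : T1} (hs : s ∈ A) : distTo A θ ≤ dist θ s := by
  refine (ENNReal.toReal_mono (edist_ne_top θ s)
    ((min_le_left _ _).trans (Metric.infEDist_le_edist_of_mem hs))).trans_eq ?_
  rw [edist_dist, ENNReal.toReal_ofReal dist_nonneg]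

/-- Points where a circle-valued function is non-zero and in the positive half circle. -/
def posSet (g : T1 → T1) : Set T1 := {s | g s ≠ 0 ∧ fr (g s) ≤ 1 / 2}

lemma ne_zero_iff_mem_posSet {g : T1 → T1} {s : T1} :
    g s ≠ 0 ↔ s ∈ posSet g ∨ s ∈ posSet (-g) := by
  constructor
  · intro h
    rcases le_total (fr (g s)) (1 / 2) with h1 | h1
    · exact Or.inl ⟨h, h1⟩
    · refine Or.inr ⟨by simpa using h, ?_⟩
      rw [Pi.neg_apply, fr_neg h]; linarith
  · rintro (h | h)
    · exact h.1
    · simpa using h.1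

/-- The zeros of `g` are approached from one side only. -/
def OneSidedZeros (g : T1 → T1) : Prop :=
  ∀ s, g s = 0 → s ∈ closure (posSet g) → s ∉ closure (posSet (-g))

lemma OneSidedZeros.neg {g : T1 → T1} (h : OneSidedZeros g) : OneSidedZeros (-g) := by
  intro s hs h1 h2
  rw [neg_neg] at h2
  exact h s (by simpa using hs) h2 h1

/-- The lower continuous lift of a circle-valued function with one-sided zeros to `[0, 1]`; on a
component of the zero set it is `0` on the part closer to positive values. -/
noncomputable def lowerLift (g : T1 → T1) (θ : T1) : ℝ :=
  open Classical in
  if g θ = 0 then max 0 ((distTo (posSet g) θ - distTo (posSet (-g)) θ) /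
    (distTo (posSet g) θ + distTo (posSet (-g)) θ)) else fr (g θ)

section lowerLift

variable {g : T1 → T1} {θ : T1}

lemma lowerLift_of_ne (h : g θ ≠ 0) : lowerLift g θ = fr (g θ) := if_neg h

lemma lowerLift_nonneg : 0 ≤ lowerLift g θ := by
  unfold lowerLift
  split_ifs
  · exact le_max_left _ _
  · exact fr_nonneg _

lemma lowerLift_le_one : lowerLift g θ ≤ 1 := by
  unfold lowerLift
  split_ifs
  · refine max_le zero_le_one (div_le_one_of_le₀ ?_ ?_)
    all_goals linarith [distTo_nonneg (posSet g) θ, distTo_nonneg (posSet (-g)) θ]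
  · exact (fr_lt_one _).le

lemma fr_le_lowerLift : fr (g θ) ≤ lowerLift g θ := by
  by_cases h : g θ = 0
  · rw [h, fr_zero]; exact lowerLift_nonneg
  · rw [lowerLift_of_ne h]

lemma lowerLift_zero_of_le (h : g θ = 0)
    (hd : distTo (posSet g) θ ≤ distTo (posSet (-g)) θ) : lowerLift g θ = 0 := by
  rw [lowerLift, if_pos h, max_eq_left]
  refine div_nonpos_of_nonpos_of_nonneg (by linarith) ?_
  linarith [distTo_nonneg (posSet g) θ, distTo_nonneg (posSet (-g)) θ]

/-- At a zero, the lift of whichever of $g$, $-g$ has the nearer positive set vanishes. This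
inequality lets a step start before it ends. -/
lemma lowerLift_add_neg_le : lowerLift g θ + lowerLift (-g) θ ≤ 1 := by
  by_cases h : g θ = 0
  · rcases le_total (distTo (posSet g) θ) (distTo (posSet (-g)) θ) with hd | hd
    · rw [lowerLift_zero_of_le h hd, zero_add]; exact lowerLift_le_one
    · rw [lowerLift_zero_of_le (g := -g) (by simpa using h) (by simpa using hd), add_zero]
      exact lowerLift_le_one
  · rw [lowerLift_of_ne h, lowerLift_of_ne (by simpa using h), Pi.neg_apply, fr_neg h]; linarith

/-- At a zero, one-sidedness keeps the denominator positive. If positive values accumulate there,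
both branches tend to 0; if negative ones do, both tend to 1; otherwise $g$ vanishes nearby and only
the quotient is seen. -/
lemma continuous_lowerLift (hg : Continuous g) (h : OneSidedZeros g) :
    Continuous (lowerLift g) := by
  rw [continuous_iff_continuousAt]
  intro θ
  by_cases h0 : g θ = 0
  swap
  · have he : lowerLift g =ᶠ[𝓝 θ] fun s => fr (g s) := by
      filter_upwards [hg.continuousAt.eventually_ne h0] with s hs using lowerLift_of_ne hs
    exact ((continuousAt_fr h0).comp hg.continuousAt).congr he.symm
  set q : T1 → ℝ := fun s => max 0 ((distTo (posSet g) s - distTo (posSet (-g)) s) /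
    (distTo (posSet g) s + distTo (posSet (-g)) s)) with hq
  have hqθ : lowerLift g θ = q θ := if_pos h0
  have hqs : ∀ s, g s = 0 → lowerLift g s = q s := fun s hs => if_pos hs
  have hpos : 0 < distTo (posSet g) θ + distTo (posSet (-g)) θ := by
    by_cases h1 : θ ∈ closure (posSet g)
    · linarith [distTo_pos (h θ h0 h1), distTo_nonneg (posSet g) θ]
    · linarith [distTo_pos h1, distTo_nonneg (posSet (-g)) θ]
  have hqc : ContinuousAt q θ := by
    have c1 := (continuous_distTo (posSet g)).continuousAt (x := θ)
    have c2 := (continuous_distTo (posSet (-g))).continuousAt (x := θ)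
    exact continuousAt_const.max ((c1.sub c2).div (c1.add c2) hpos.ne')
  have hn : Tendsto (fun s => ‖g s‖) (𝓝 θ) (𝓝 0) := by
    have := hg.norm.continuousAt (x := θ)
    rwa [ContinuousAt, h0, norm_zero] at this
  have hnot : ∀ A : Set T1, θ ∉ closure A → ∀ᶠ s in 𝓝 θ, s ∉ A := fun A hA => by
    filter_upwards [isClosed_closure.isOpen_compl.mem_nhds hA] with s hs hsA
    exact hs (subset_closure hsA)
  rw [ContinuousAt, hqθ]
  by_cases h1 : θ ∈ closure (posSet g)
  · have h2 := hnot _ (h θ h0 h1)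
    have hq0 : q θ = 0 := by
      rw [← hqθ]
      exact lowerLift_zero_of_le h0 (by rw [distTo_eq_zero h1]; exact distTo_nonneg _ _)
    have hlim : Tendsto (fun s => max (q s) ‖g s‖) (𝓝 θ) (𝓝 (max (q θ) 0)) := hqc.max hn
    rw [hq0, max_self] at hlim
    rw [hq0]
    refine tendsto_of_tendsto_of_tendsto_of_le_of_le' tendsto_const_nhds hlim
      (Eventually.of_forall fun s => lowerLift_nonneg) ?_
    filter_upwards [h2] with s hs
    by_cases hs0 : g s = 0
    · rw [hqs s hs0]; exact le_max_left _ _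
    · have := (ne_zero_iff_mem_posSet.1 hs0).resolve_right hs
      rw [lowerLift_of_ne hs0]
      refine le_max_of_le_right ?_
      rw [norm_eq_min_fr]
      exact le_min le_rfl (by linarith [this.2])
  · have h1' := hnot _ h1
    by_cases h2 : θ ∈ closure (posSet (-g))
    · have hq1 : q θ = 1 := by
        simp only [hq, distTo_eq_zero h2, sub_zero, add_zero, div_self (distTo_pos h1).ne']
        simp
      have hlim : Tendsto (fun s => min (q s) (1 - ‖g s‖)) (𝓝 θ) (𝓝 (min (q θ) (1 - 0))) :=
        hqc.min (tendsto_const_nhds.sub hn)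
      rw [hq1, sub_zero, min_self] at hlim
      rw [hq1]
      refine tendsto_of_tendsto_of_tendsto_of_le_of_le' hlim tendsto_const_nhds ?_
        (Eventually.of_forall fun s => lowerLift_le_one)
      filter_upwards [h1'] with s hs
      by_cases hs0 : g s = 0
      · rw [hqs s hs0]; exact min_le_left _ _
      · have := ((ne_zero_iff_mem_posSet.1 hs0).resolve_left hs).2
        rw [lowerLift_of_ne hs0]
        refine min_le_of_right_le ?_
        rw [Pi.neg_apply, fr_neg hs0] at this
        rw [norm_eq_min_fr, min_eq_right (by linarith)]
        linarith
    · have h2' := hnot _ h2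
      refine Tendsto.congr' ?_ hqc
      filter_upwards [h1', h2'] with s hs1 hs2
      have : g s = 0 := by
        by_contra hs0
        exact (ne_zero_iff_mem_posSet.1 hs0).elim hs1 hs2
      exact (hqs s this).symm

end lowerLift

/-! ### Acyclicity of the order induced by the lower lifts -/

lemma exists_dist_lt_of_dist_lt {θ s : T1} {δ η : ℝ} (hδ : 0 ≤ δ) (hη : 0 < η)
    (h : dist θ s < δ + η) : ∃ r, (dist θ r < δ ∨ r = θ) ∧ dist s r < η := by
  rcases hδ.eq_or_lt with rfl | hδ
  · exact ⟨θ, Or.inr rfl, by rwa [dist_comm, ← zero_add η]⟩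
  obtain ⟨t, ht, htn⟩ := exists_coe_eq_abs_eq_norm (s - θ)
  rw [dist_comm, dist_eq_norm, ← htn] at h
  have h0 : dist (0 : ℝ) t < δ + η := by simpa [dist_eq_norm] using h
  rw [add_comm] at h0
  obtain ⟨u, hu1, hu2⟩ := exists_dist_lt_lt hδ hη h0
  refine ⟨θ + (u : T1), Or.inl ?_, ?_⟩
  · rw [dist_eq_norm, sub_add_cancel_left, norm_neg]
    exact (norm_coe_le u).trans_lt (by simpa [dist_eq_norm] using hu1)
  · rw [dist_eq_norm, show s - (θ + (u : T1)) = ((t - u : ℝ) : T1) by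
      rw [AddCircle.coe_sub, ht]; abel]
    refine (norm_coe_le _).trans_lt ?_
    rwa [dist_comm, dist_eq_norm, Real.norm_eq_abs] at hu2

section sink

variable {ι : Type*} {c : ι → T1 → T1}

/-- The truncated distance of `θ` to the set where `c n` is just below `c m`. -/
noncomputable def distBelow (c : ι → T1 → T1) (θ : T1) (n m : ι) : ℝ :=
  distTo (posSet (c m - c n)) θ

/-- No two curves of `X` separate within distance δ of θ, so all agree there; uniform continuity
keeps them close slightly beyond. -/
lemma exists_close_of_distBelow (hc : ∀ n, Continuous (c n)) {θ : T1} {X : Finset ι} {δ : ℝ}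
    (hδ : 0 ≤ δ) (hX : ∀ n ∈ X, ∀ m ∈ X, c n θ = c m θ)
    (hd : ∀ n ∈ X, ∀ m ∈ X, δ ≤ distBelow c θ n m) :
    ∃ η > 0, ∀ s, dist θ s < δ + η → ∀ n ∈ X, ∀ m ∈ X, ‖c n s - c m s‖ < 1 / 8 := by
  have huc : ∀ n ∈ X, ∃ η > 0, ∀ s r, dist s r < η → dist (c n s) (c n r) < 1 / 16 := fun n _ => by
    have := CompactSpace.uniformContinuous_of_continuous (hc n)
    obtain ⟨η, h, h'⟩ := Metric.uniformContinuous_iff.1 this (1 / 16) (by norm_num)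
    exact ⟨η, h, fun s r => @h' s r⟩
  obtain ⟨η, hη, hηX⟩ : ∃ η > 0, ∀ n ∈ X, ∀ s r, dist s r < η → dist (c n s) (c n r) < 1 / 16 := by
    choose! e he he' using huc
    rcases X.eq_empty_or_nonempty with rfl | hne
    · exact ⟨1, one_pos, by simp⟩
    · refine ⟨X.inf' hne e, (Finset.lt_inf'_iff hne).2 he, fun n hn s r hsr => ?_⟩
      exact he' n hn s r (hsr.trans_le (Finset.inf'_le _ hn))
  refine ⟨η, hη, fun s hs n hn m hm => ?_⟩
  obtain ⟨r, hr, hsr⟩ := exists_dist_lt_of_dist_lt hδ hη hs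
  have heq : c n r = c m r := by
    rcases hr with hr | rfl
    · by_contra hne
      have : (c m - c n) r ≠ 0 := by
        simpa [sub_eq_zero] using Ne.symm hne
      rcases ne_zero_iff_mem_posSet.1 this with h | h
      · exact absurd (distTo_le_dist h) (not_le.2 (hr.trans_le (hd n hn m hm)))
      · rw [neg_sub] at h
        exact absurd (distTo_le_dist h) (not_le.2 (hr.trans_le (hd m hm n hn)))
    · exact hX n hn m hm
  have h1 := hηX n hn s r hsr
  have h2 := hηX m hm s r hsr
  rw [← dist_eq_norm]
  have h3 := dist_triangle (c n s) (c n r) (c m s)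
  have h4 : dist (c n r) (c m s) < 1 / 16 := by rwa [heq, dist_comm]
  linarith

lemma exists_lt_dist_of_distTo_lt {A : Set T1} {θ : T1} {r : ℝ} (hr : r < 1)
    (h : ∃ η > 0, ∀ s, dist θ s < r + η → s ∉ A) (h0 : 0 ≤ r) : r < distTo A θ := by
  obtain ⟨η, hη, h⟩ := h
  have h1 : ENNReal.ofReal (r + η) ≤ Metric.infEDist θ A := by
    refine Metric.le_infEDist.2 fun s hs => ?_
    by_contra hlt
    rw [not_le, edist_dist] at hlt
    exact h s ((ENNReal.ofReal_lt_ofReal_iff (by linarith)).1 hlt) hs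
  have h2 : ENNReal.ofReal (min (r + η) 1) ≤ min (Metric.infEDist θ A) 1 := by
    refine le_min ((ENNReal.ofReal_le_ofReal (min_le_left _ _)).trans h1) ?_
    simp
  have h3 := ENNReal.toReal_mono ((min_le_right _ _).trans_lt ENNReal.one_lt_top).ne h2
  rw [ENNReal.toReal_ofReal (le_min (by linarith) zero_le_one)] at h3
  exact (lt_min (by linarith) hr).trans_le h3

lemma fr_lt_of_norm_lt {z : T1} (hz : ‖z‖ < 1 / 8) (h : z ∉ {z | z ≠ 0 ∧ fr z ≤ 1 / 2}) :
    fr (-z) < 1 / 8 := by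
  rcases eq_or_ne z 0 with rfl | h0
  · simp [fr_zero]
  · rw [fr_neg h0]
    rw [norm_eq_min_fr, min_lt_iff] at hz
    simp only [mem_ofPred_eq, not_and, not_le] at h
    rcases hz with hz | hz
    · linarith [h h0]
    · exact hz

/-- The relation `δ < distBelow m n`, read as `n ≤ m` at scale `δ`, is transitive. -/
lemma lt_distBelow_trans (hc : ∀ n, Continuous (c n)) {θ : T1} {X : Finset ι} {δ : ℝ}
    (hδ : 0 ≤ δ) (hX : ∀ n ∈ X, ∀ m ∈ X, c n θ = c m θ)
    (hd : ∀ n ∈ X, ∀ m ∈ X, δ ≤ distBelow c θ n m) {n m k : ι} (hn : n ∈ X) (hm : m ∈ X)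
    (hk : k ∈ X) (h1 : δ < distBelow c θ m n) (h2 : δ < distBelow c θ k m) :
    δ < distBelow c θ k n := by
  obtain ⟨η, hη, hclose⟩ := exists_close_of_distBelow hc hδ hX hd
  have hδ1 : δ < 1 := h1.trans_le (distTo_le_one _ _)
  refine exists_lt_dist_of_distTo_lt hδ1 ⟨min η (min (distBelow c θ m n - δ)
    (distBelow c θ k m - δ)), by simp [hη, h1, h2], fun s hs => ?_⟩ hδ
  have hs1 : dist θ s < δ + η := hs.trans_le (by gcongr; exact min_le_left _ _)
  have hs2 : dist θ s < distBelow c θ m n := by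
    have := (min_le_right η (min (distBelow c θ m n - δ) (distBelow c θ k m - δ))).trans
      (min_le_left _ _)
    linarith
  have hs3 : dist θ s < distBelow c θ k m := by
    have := (min_le_right η (min (distBelow c θ m n - δ) (distBelow c θ k m - δ))).trans
      (min_le_right _ _)
    linarith
  have a1 : s ∉ posSet (c n - c m) := fun h => absurd (distTo_le_dist h) (not_le.2 hs2)
  have a2 : s ∉ posSet (c m - c k) := fun h => absurd (distTo_le_dist h) (not_le.2 hs3)
  have b1 := fr_lt_of_norm_lt (hclose s hs1 n hn m hm) a1
  have b2 := fr_lt_of_norm_lt (hclose s hs1 m hm k hk) a2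
  -- Both upward displacements are below 1/8, so they add without wrapping around, and the sum stays
  -- below the 1/2 that the opposite order would require.
  have b3 : fr (-(c n s - c k s)) < 1 / 4 := by
    rw [show -(c n s - c k s) = -(c n s - c m s) + -(c m s - c k s) by abel,
      fr_add_of_lt (by linarith)]
    linarith
  rintro ⟨hne, hle⟩
  rw [Pi.sub_apply] at hne hle
  rw [fr_neg hne] at b3
  linarith

/-- Among finitely many curves which agree at `θ` there is one which is nowhere pushed down. -/
lemma exists_sink (hc : ∀ n, Continuous (c n)) {θ : T1} (X : Finset ι) (hne : X.Nonempty)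
    (hX : ∀ n ∈ X, ∀ m ∈ X, c n θ = c m θ) :
    ∃ x ∈ X, ∀ m ∈ X, distBelow c θ m x ≤ distBelow c θ x m := by
  classical
  induction hcard : X.card using Nat.strong_induction_on generalizing X with
  | _ N ih =>
  subst hcard
  by_cases hall : ∀ n ∈ X, ∀ m ∈ X, distBelow c θ m n ≤ distBelow c θ n m
  · obtain ⟨x, hx⟩ := hne
    exact ⟨x, hx, hall x hx⟩
  push Not at hall
  obtain ⟨n1, hn1, m1, hm1, hlt1⟩ := hall
  -- Take the smallest scale δ at which some pair separates. The pair attaining it is not equivalent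
  -- at scale δ, so the class of a maximal element is a proper subset, to which induction applies.
  obtain ⟨⟨n0, m0⟩, hp0, hmin⟩ := (X ×ˢ X).exists_min_image
    (fun p => distBelow c θ p.1 p.2) ⟨(n1, m1), Finset.mk_mem_product hn1 hm1⟩
  rw [Finset.mem_product] at hp0
  set δ := distBelow c θ n0 m0 with hδdef
  have hδ : 0 ≤ δ := distTo_nonneg _ _
  have hd : ∀ n ∈ X, ∀ m ∈ X, δ ≤ distBelow c θ n m := fun n hn m hm =>
    hmin (n, m) (Finset.mk_mem_product hn hm)
  have htr := @lt_distBelow_trans ι c hc θ X δ hδ hX hd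
  have hδ1 : δ < 1 := (hd n1 hn1 m1 hm1).trans_lt (hlt1.trans_le (distTo_le_one _ _))
  have hrefl : ∀ n, δ < distBelow c θ n n := fun n => by
    have : posSet (c n - c n) = ∅ := by
      ext s; simp [posSet]
    rw [distBelow, this, distTo, Metric.infEDist_empty, min_eq_right le_top, ENNReal.toReal_one]
    exact hδ1
  -- `le n m` means that `n` is below `m` at scale `δ`
  let P : Preorder X :=
    { le := fun n m => δ < distBelow c θ m n
      le_refl := fun n => hrefl n
      le_trans := fun n m k h1 h2 => htr n.2 m.2 k.2 h1 h2 }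
  obtain ⟨x, -, hmax⟩ := (Finset.univ : Finset X).exists_maximal ⟨⟨n0, hp0.1⟩, Finset.mem_univ _⟩
  have hmax' : ∀ m ∈ X, δ < distBelow c θ m x → δ < distBelow c θ x m := fun m hm h =>
    hmax (y := ⟨m, hm⟩) (Finset.mem_univ _) h
  set X' := X.filter fun m => δ < distBelow c θ m x ∧ δ < distBelow c θ x m with hX'
  have hsub : X' ⊂ X := by
    refine (Finset.filter_subset _ _).ssubset_of_ne fun heq => ?_
    have e1 := hp0.1
    have e2 := hp0.2
    rw [← heq, Finset.mem_filter] at e1 e2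
    exact lt_irrefl _ (hδdef ▸ htr hp0.2 x.2 hp0.1 e2.2.2 e1.2.1)
  obtain ⟨y, hy, hysink⟩ := ih X'.card (Finset.card_lt_card hsub) X'
    ⟨x, Finset.mem_filter.2 ⟨x.2, hrefl x, hrefl x⟩⟩
    (fun n hn m hm => hX n (hsub.1 hn) m (hsub.1 hm)) rfl
  have hyX := (Finset.mem_filter.1 hy).1
  obtain ⟨hy1, hy2⟩ := (Finset.mem_filter.1 hy).2
  refine ⟨y, hyX, fun m hm => ?_⟩
  by_cases hmX' : m ∈ X'
  · exact hysink m hmX'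
  by_contra hlt
  rw [not_le] at hlt
  have h1 : δ < distBelow c θ m y := (hd y hyX m hm).trans_lt hlt
  have h2 : δ < distBelow c θ m x := htr x.2 hyX hm hy1 h1
  exact hmX' (Finset.mem_filter.2 ⟨hm, h2, hmax' m hm h2⟩)

end sink

/-! ### Finite unions of non-trivial intervals -/

/-- Near each point of `C` the complement of `C` is an interval. -/
def LocallyIntervalCompl (C : Set T1) : Prop :=
  ∀ t : ℝ, (t : T1) ∈ C → ∃ ε > 0, ({s : ℝ | (s : T1) ∉ C} ∩ Ioo (t - ε) (t + ε)).OrdConnected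

lemma LocallyIntervalCompl.preimage_sub {C : Set T1} (h : LocallyIntervalCompl C) (c : T1) :
    LocallyIntervalCompl {θ | θ - c ∈ C} := by
  intro t ht
  have hc : ∀ s : ℝ, ((s - fr c : ℝ) : T1) = (s : T1) - c := fun s => by
    rw [AddCircle.coe_sub, coe_fr]
  obtain ⟨ε, hε, ho⟩ := h (t - fr c) (by rw [hc]; exact ht)
  refine ⟨ε, hε, ?_⟩
  have := ho.preimage_mono (f := fun s : ℝ => s - fr c) fun a b hab => by simpa using hab
  convert! this using 1
  ext s
  simp only [mem_inter_iff, mem_ofPred_eq, mem_Ioo, mem_preimage, hc]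
  constructor <;> rintro ⟨h1, h2, h3⟩ <;> exact ⟨h1, by linarith, by linarith⟩

/-- Values of both signs near a zero would lie over one interval free of zeros. There `fr ∘ g` is
continuous and would have to pass through 1/2, although $g$ stays close to 0. -/
lemma LocallyIntervalCompl.oneSidedZeros {g : T1 → T1} (hg : Continuous g)
    (h : LocallyIntervalCompl {θ | g θ = 0}) : OneSidedZeros g := by
  intro θ hθ h1 h2
  obtain ⟨t, rfl⟩ : ∃ t : ℝ, (t : T1) = θ := ⟨fr θ, coe_fr θ⟩
  obtain ⟨ε, hε, ho⟩ := h t hθ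
  have hnear : ∀ᶠ s in 𝓝 (t : T1), ‖g s‖ < 1 / 4 := by
    have := hg.norm.continuousAt (x := (t : T1))
    rw [ContinuousAt, hθ, norm_zero] at this
    exact this.eventually_lt_const (by norm_num)
  obtain ⟨ε', hε', hnear⟩ := Metric.eventually_nhds_iff.1 hnear
  have hrep : ∀ A : Set T1, (t : T1) ∈ closure A →
      ∃ s : ℝ, (s : T1) ∈ A ∧ |s - t| < min ε ε' := fun A hA => by
    obtain ⟨b, hb, hd⟩ := Metric.mem_closure_iff.1 hA (min ε ε') (lt_min hε hε')
    obtain ⟨u, hu, hun⟩ := exists_coe_eq_abs_eq_norm (b - (t : T1))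
    refine ⟨t + u, ?_, ?_⟩
    · rwa [AddCircle.coe_add, hu, add_sub_cancel]
    · rw [add_sub_cancel_left, hun, ← dist_eq_norm, dist_comm]; exact hd
  obtain ⟨s1, hs1, hd1⟩ := hrep _ h1
  obtain ⟨s2, hs2, hd2⟩ := hrep _ h2
  have hlt : ∀ s, |s - t| < min ε ε' → ‖g (s : T1)‖ < 1 / 4 := fun s hs => by
    refine hnear ?_
    rw [dist_eq_norm, ← AddCircle.coe_sub]
    exact (norm_coe_le _).trans_lt (hs.trans_le (min_le_right _ _))
  have hne1 := hs1.1
  have hne2 : g (s2 : T1) ≠ 0 := by simpa using hs2.1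
  have hmem : ∀ s : ℝ, g (s : T1) ≠ 0 → |s - t| < min ε ε' →
      s ∈ {s : ℝ | (s : T1) ∉ {θ | g θ = 0}} ∩ Ioo (t - ε) (t + ε) := fun s h0 hs => by
    have := abs_lt.1 (hs.trans_le (min_le_left _ _))
    exact ⟨h0, by linarith, by linarith⟩
  have hsub := ho.uIcc_subset (hmem s1 hne1 hd1) (hmem s2 hne2 hd2)
  have hcont : ContinuousOn (fun s : ℝ => fr (g (s : T1))) (uIcc s1 s2) := fun s hs =>
    (ContinuousAt.comp (f := fun s : ℝ => g (s : T1)) (continuousAt_fr (hsub hs).1)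
      (hg.comp (AddCircle.continuous_mk' 1)).continuousAt).continuousWithinAt
  have hv : (1 / 2 : ℝ) ∈ uIcc (fr (g (s1 : T1))) (fr (g (s2 : T1))) := by
    refine Icc_subset_uIcc ⟨hs1.2, ?_⟩
    have := hs2.2
    rw [Pi.neg_apply, fr_neg hne2] at this
    linarith
  obtain ⟨s, hs, hse⟩ := intermediate_value_uIcc hcont hv
  simp only at hse
  have hst : |s - t| < min ε ε' := by
    rw [← Real.dist_eq, ← Metric.mem_ball, Real.ball_eq_Ioo] at hd1 hd2 ⊢
    exact ordConnected_Ioo.uIcc_subset hd1 hd2 hs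
  have := hlt s hst
  rw [norm_eq_min_fr, hse] at this
  norm_num at this

/-- On the right of every point, the periodic set generated by an interval is locally full or
locally empty. -/
lemma exists_right_germ {J : Set ℝ} (hJ : J.OrdConnected) (t : ℝ) :
    (∃ ε > 0, ∀ s ∈ Ioo t (t + ε), ∃ k : ℤ, s + k ∈ J) ∨
      ∃ ε > 0, ∀ s ∈ Ioo t (t + ε), ∀ k : ℤ, s + k ∉ J := by
  by_contra hcon
  push Not at hcon
  obtain ⟨hin, hout⟩ := hcon
  obtain ⟨s1, ⟨ht1, ht1'⟩, k1, hk1⟩ := hout 1 one_pos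
  obtain ⟨r, ⟨hr, hr'⟩, hrn⟩ := hin (s1 - t) (by linarith)
  obtain ⟨s, ⟨hs, hs'⟩, k, hk⟩ := hout (r - t) (by linarith)
  have hne : ∀ l : ℤ, ¬ (s + k ≤ r + l ∧ r + l ≤ s1 + k1) := fun l hl =>
    hrn l (hJ.out hk hk1 ⟨hl.1, hl.2⟩)
  have hne' : ∀ l : ℤ, ¬ (s1 + k1 ≤ r + l ∧ r + l ≤ s + k) := fun l hl =>
    hrn l (hJ.out hk1 hk ⟨hl.1, hl.2⟩)
  rcases lt_trichotomy k k1 with hlt | rfl | hlt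
  · have : (k : ℝ) + 1 ≤ k1 := by exact_mod_cast hlt
    exact hne k ⟨by linarith, by linarith⟩
  · exact hne k ⟨by linarith, by linarith⟩
  -- Here `J` contains $[s_1+k_1,\,s+k]$, and since $s_1<t+1$ this interval covers the translate of
  -- $(t,s)$ by $k_1+1$.
  · obtain ⟨r', ⟨hr1, hr1'⟩, hrn'⟩ := hin (s - t) (by linarith)
    have : (k1 : ℝ) + 1 ≤ k := by exact_mod_cast hlt
    exact hrn' (k1 + 1) (hJ.out hk1 hk ⟨by push_cast; linarith, by push_cast; linarith⟩)

lemma exists_left_germ {J : Set ℝ} (hJ : J.OrdConnected) (t : ℝ) :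
    (∃ ε > 0, ∀ s ∈ Ioo (t - ε) t, ∃ k : ℤ, s + k ∈ J) ∨
      ∃ ε > 0, ∀ s ∈ Ioo (t - ε) t, ∀ k : ℤ, s + k ∉ J := by
  have hJ' : (Neg.neg ⁻¹' J).OrdConnected := hJ.preimage_anti fun a b h => neg_le_neg h
  rcases exists_right_germ hJ' (-t) with ⟨ε, hε, h⟩ | ⟨ε, hε, h⟩
  · refine Or.inl ⟨ε, hε, fun s hs => ?_⟩
    obtain ⟨k, hk⟩ := h (-s) ⟨by linarith [hs.2], by linarith [hs.1]⟩
    refine ⟨-k, ?_⟩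
    rwa [mem_preimage, show -(-s + (k : ℝ)) = s + ((-k : ℤ) : ℝ) by push_cast; ring] at hk
  · refine Or.inr ⟨ε, hε, fun s hs k hk => h (-s) ⟨by linarith [hs.2], by linarith [hs.1]⟩ (-k) ?_⟩
    rwa [mem_preimage, show -(-s + ((-k : ℤ) : ℝ)) = s + (k : ℝ) by push_cast; ring]

lemma coe_mem_image_coe {J : Set ℝ} {s : ℝ} :
    (s : T1) ∈ (fun t : ℝ => (t : T1)) '' J ↔ ∃ k : ℤ, s + k ∈ J := by
  constructor
  · rintro ⟨j, hj, hjs⟩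
    obtain ⟨k, hk⟩ := coe_eq_coe_iff_int.1 hjs
    exact ⟨k, hk ▸ hj⟩
  · rintro ⟨k, hk⟩
    exact ⟨s + k, hk, coe_eq_coe_iff_int.2 ⟨k, rfl⟩⟩

lemma decided_sUnion {S : Set (Set T1)} (hS : S.Finite) {l : Filter ℝ}
    (h : ∀ I ∈ S, (∀ᶠ s : ℝ in l, (s : T1) ∈ I) ∨ ∀ᶠ s : ℝ in l, (s : T1) ∉ I) :
    (∀ᶠ s : ℝ in l, (s : T1) ∈ ⋃₀ S) ∨ ∀ᶠ s : ℝ in l, (s : T1) ∉ ⋃₀ S := by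
  by_cases hex : ∃ I ∈ S, ∀ᶠ s : ℝ in l, (s : T1) ∈ I
  · obtain ⟨I, hI, hev⟩ := hex
    exact Or.inl (hev.mono fun s hs => ⟨I, hI, hs⟩)
  · refine Or.inr ?_
    have := (eventually_all_finite hS).2 fun I hI => (h I hI).resolve_left fun hcon => hex ⟨I, hI, hcon⟩
    filter_upwards [this] with s hs
    rintro ⟨I, hI, hsI⟩
    exact hs I hI hsI

/-- On each side of a point the finite union is locally full or locally empty, and non-triviality
makes it full on at least one side. Hence the complement is locally empty or a one-sided interval.
-/
lemma locallyIntervalCompl_sUnion {S : Set (Set T1)} (hS : S.Finite)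
    (hI : ∀ I ∈ S, IsNontrivialInterval I) : LocallyIntervalCompl (⋃₀ S) := by
  intro t ht
  have hR : (∀ᶠ s : ℝ in 𝓝[>] t, (s : T1) ∈ ⋃₀ S) ∨ ∀ᶠ s : ℝ in 𝓝[>] t, (s : T1) ∉ ⋃₀ S := by
    refine decided_sUnion hS fun I hIS => ?_
    obtain ⟨J, hJ, -, rfl⟩ := hI I hIS
    simp only [coe_mem_image_coe, not_exists]
    rcases exists_right_germ hJ t with ⟨ε, hε, h⟩ | ⟨ε, hε, h⟩
    · exact Or.inl (eventually_of_mem (Ioo_mem_nhdsGT (by linarith)) h)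
    · exact Or.inr (eventually_of_mem (Ioo_mem_nhdsGT (by linarith)) h)
  have hL : (∀ᶠ s : ℝ in 𝓝[<] t, (s : T1) ∈ ⋃₀ S) ∨ ∀ᶠ s : ℝ in 𝓝[<] t, (s : T1) ∉ ⋃₀ S := by
    refine decided_sUnion hS fun I hIS => ?_
    obtain ⟨J, hJ, -, rfl⟩ := hI I hIS
    simp only [coe_mem_image_coe, not_exists]
    rcases exists_left_germ hJ t with ⟨ε, hε, h⟩ | ⟨ε, hε, h⟩
    · exact Or.inl (eventually_of_mem (Ioo_mem_nhdsLT (by linarith)) h)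
    · exact Or.inr (eventually_of_mem (Ioo_mem_nhdsLT (by linarith)) h)
  have hone : (∀ᶠ s : ℝ in 𝓝[>] t, (s : T1) ∈ ⋃₀ S) ∨ ∀ᶠ s : ℝ in 𝓝[<] t, (s : T1) ∈ ⋃₀ S := by
    obtain ⟨I, hIS, htI⟩ := ht
    obtain ⟨J, hJ, hJn, rfl⟩ := hI I hIS
    obtain ⟨k, hk⟩ := coe_mem_image_coe.1 htI
    obtain ⟨j, hj, hne⟩ := hJn.exists_ne (t + k)
    rcases hne.lt_or_gt with hlt | hlt
    · refine Or.inr (eventually_of_mem (Ioo_mem_nhdsLT (show j - k < t by linarith)) fun s hs => ?_)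
      exact ⟨_, hIS, coe_mem_image_coe.2 ⟨k, hJ.out hj hk ⟨by linarith [hs.1], by linarith [hs.2]⟩⟩⟩
    · refine Or.inl (eventually_of_mem (Ioo_mem_nhdsGT (show t < j - k by linarith)) fun s hs => ?_)
      exact ⟨_, hIS, coe_mem_image_coe.2 ⟨k, hJ.out hk hj ⟨by linarith [hs.1], by linarith [hs.2]⟩⟩⟩
  have key : ∃ T : Set ℝ, T.OrdConnected ∧ ∀ᶠ s : ℝ in 𝓝 t, ((s : T1) ∉ ⋃₀ S ↔ s ∈ T) := by
    have hsplit : ∀ p : ℝ → Prop, (∀ᶠ s in 𝓝[<] t, p s) → p t → (∀ᶠ s in 𝓝[>] t, p s) →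
        ∀ᶠ s in 𝓝 t, p s := fun p h1 h2 h3 => by
      rw [eventually_nhdsWithin_iff] at h1 h3
      filter_upwards [h1, h3] with s a b
      rcases lt_trichotomy s t with h | rfl | h
      exacts [a h, h2, b h]
    by_cases hRin : ∀ᶠ s : ℝ in 𝓝[>] t, (s : T1) ∈ ⋃₀ S
    · rcases hL with hL | hL
      · refine ⟨∅, ordConnected_empty, hsplit _ ?_ ?_ ?_⟩
        · filter_upwards [hL] with s hs; simpa using hs
        · simpa using ht
        · filter_upwards [hRin] with s hs; simpa using hs
      · refine ⟨Iio t, ordConnected_Iio, hsplit _ ?_ ?_ ?_⟩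
        · filter_upwards [hL, self_mem_nhdsWithin] with s hs hst
          exact iff_of_true hs hst
        · exact iff_of_false (not_not.2 ht) (lt_irrefl t)
        · filter_upwards [hRin, self_mem_nhdsWithin] with s hs hst
          exact iff_of_false (not_not.2 hs) fun h => lt_asymm (a := s) (b := t) h hst
    · refine ⟨Ioi t, ordConnected_Ioi, hsplit _ ?_ ?_ ?_⟩
      · filter_upwards [hone.resolve_left hRin, self_mem_nhdsWithin] with s hs hst
        exact iff_of_false (not_not.2 hs) fun h => lt_asymm (a := t) (b := s) h hst
      · exact iff_of_false (not_not.2 ht) (lt_irrefl t)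
      · filter_upwards [hR.resolve_left hRin, self_mem_nhdsWithin] with s hs hst
        exact iff_of_true hs hst
  obtain ⟨T, hT, hev⟩ := key
  obtain ⟨ε, hε, hev⟩ := Metric.eventually_nhds_iff.1 hev
  refine ⟨ε, hε, ?_⟩
  have : {s : ℝ | (s : T1) ∉ ⋃₀ S} ∩ Ioo (t - ε) (t + ε) = T ∩ Ioo (t - ε) (t + ε) := by
    ext s
    refine and_congr_left fun hs => hev ?_
    rw [Real.dist_eq, abs_lt]
    constructor <;> linarith [hs.1, hs.2]
  rw [this]
  exact hT.inter ordConnected_Ioo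

/-! ### The blown-up torus -/

/-- `s` lies between the lower and the upper value at `(θ, x)` of the sum of saw-tooth functions
with discontinuities along the curves `c n`. -/
def IsHeight (a : ℤ → ℝ) (c : ℤ → T1 → T1) (θ x : T1) (s : ℝ) : Prop :=
  ∑' n : ℤ, a n * fr (x - c n θ) ≤ s ∧ ∑' n : ℤ, a n * fr (c n θ - x) ≤ ∑' n : ℤ, a n - s

namespace IsWeight

variable {a : ℤ → ℝ} (ha : IsWeight a) {c : ℤ → T1 → T1}
include ha

lemma summable_fr (z : ℤ → T1) : Summable fun n => a n * fr (z n) :=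
  ha.summable_mul (fun _ => fr_nonneg _) fun _ => (fr_lt_one _).le

lemma tsum_fr_nonneg (z : ℤ → T1) : 0 ≤ ∑' n, a n * fr (z n) :=
  tsum_nonneg fun n => mul_nonneg (ha.pos n).le (fr_nonneg _)

lemma tsum_pos : 0 < ∑' n, a n := ha.summable.tsum_pos (fun n => (ha.pos n).le) 0 (ha.pos 0)

lemma isClosed_setOf_isHeight (hc : ∀ n, Continuous (c n)) :
    IsClosed {p : T2 × ℝ | IsHeight a c p.1.1 p.1.2 p.2} :=
  (ha.isClosed_tsum_fr_le (fun n => by have := hc n; fun_prop) (by fun_prop)).inter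
    (ha.isClosed_tsum_fr_le (fun n => by have := hc n; fun_prop) (by fun_prop))

lemma isCompact_setOf_isHeight (hc : ∀ n, Continuous (c n)) :
    IsCompact {p : T2 × ℝ | IsHeight a c p.1.1 p.1.2 p.2} := by
  refine (isCompact_univ.prod (isCompact_Icc (a := (0 : ℝ)) (b := ∑' n, a n))).of_isClosed_subset
    (ha.isClosed_setOf_isHeight hc) fun p hp => ⟨mem_univ _, ?_, ?_⟩
  · exact (ha.tsum_fr_nonneg _).trans hp.1
  · have := (ha.tsum_fr_nonneg _).trans hp.2; linarith

/-- Heights grow at a rate strictly less than one. -/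
lemma height_sub_le {θ : T1} {x x' s s' : ℝ} (h : IsHeight a c θ x s) (h' : IsHeight a c θ x' s')
    (hx : x < x') : s' - s ≤ (∑' n, a n) * (x' - x) := by
  have h1 : ∀ n, 1 - fr (c n θ - (x' : T1)) ≤ fr ((x : T1) - c n θ) + (x' - x) := fun n => by
    have := one_sub_fr_neg_add_le ((x : T1) - c n θ) (sub_pos.2 hx)
    rwa [show -((x : T1) - c n θ + ((x' - x : ℝ) : T1)) = c n θ - (x' : T1) by
      rw [AddCircle.coe_sub]; abel] at this
  have h2 : ∑' n, a n ≤ ∑' n, (a n * fr (c n θ - (x' : T1)) +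
      (a n * fr ((x : T1) - c n θ) + a n * (x' - x))) := by
    refine ha.summable.tsum_le_tsum (fun n => ?_)
      ((ha.summable_fr _).add ((ha.summable_fr _).add (ha.summable.mul_right _)))
    nlinarith [h1 n, ha.pos n]
  rw [(ha.summable_fr _).tsum_add ((ha.summable_fr _).add (ha.summable.mul_right _)),
    (ha.summable_fr _).tsum_add (ha.summable.mul_right _), tsum_mul_right] at h2
  linarith [h.1, h'.2]

/-- Since heights grow at rate at most $A<1$, the value $x-s$ increases strictly with $x$ and
therefore determines the triple. -/
lemma height_unique {θ : T1} {x x' s s' : ℝ} (h : IsHeight a c θ x s)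
    (h' : IsHeight a c θ x' s') (he : x - s = x' - s') : s = s' := by
  rcases lt_trichotomy x x' with hx | rfl | hx
  · have := ha.height_sub_le h h' hx
    nlinarith [ha.lt_one]
  · linarith
  · have := ha.height_sub_le h' h hx
    nlinarith [ha.lt_one]

/-- Take the least $x$ whose lower height is at most $x-y$. To its left the lower height, hence also
the upper one, exceeds $x-y$, and the bound by the upper height passes to the limit. -/
lemma exists_height (θ : T1) (y : ℝ) :
    ∃ x : ℝ, IsHeight a c θ x (x - y) := by
  have hcoe : Continuous fun x : ℝ => (x : T1) := AddCircle.continuous_mk' 1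
  have hcl1 : IsClosed {x : ℝ | ∑' n, a n * fr ((x : T1) - c n θ) ≤ x - y} :=
    ha.isClosed_tsum_fr_le (fun n => by fun_prop) (by fun_prop)
  have hcl2 : IsClosed {x : ℝ | ∑' n, a n * fr (c n θ - (x : T1)) ≤ ∑' n, a n - (x - y)} :=
    ha.isClosed_tsum_fr_le (fun n => by fun_prop) (by fun_prop)
  set S := {x : ℝ | ∑' n, a n * fr ((x : T1) - c n θ) ≤ x - y} with hS
  have hle : ∀ z : ℤ → T1, ∑' n, a n * fr (z n) ≤ ∑' n, a n := fun z =>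
    (ha.summable_fr z).tsum_le_tsum
      (fun n => mul_le_of_le_one_right (ha.pos n).le (fr_lt_one _).le) ha.summable
  have hne : S.Nonempty := by
    refine ⟨y + 1, ?_⟩
    rw [hS, mem_ofPred_eq, add_sub_cancel_left]
    exact (hle _).trans ha.lt_one.le
  have hbdd : BddBelow S := ⟨y, fun x hx => by
    have := (ha.tsum_fr_nonneg _).trans (show _ ≤ x - y from hx)
    linarith⟩
  refine ⟨sInf S, hcl1.csInf_mem hne hbdd, ?_⟩
  have hsub : Iio (sInf S) ⊆ {x : ℝ | ∑' n, a n * fr (c n θ - (x : T1)) ≤ ∑' n, a n - (x - y)} := by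
    intro x hx
    have hxS : x - y < ∑' n, a n * fr ((x : T1) - c n θ) :=
      not_le.1 fun h => notMem_of_lt_csInf hx hbdd h
    have h1 : ∑' n, a n * fr (c n θ - (x : T1)) + ∑' n, a n * fr ((x : T1) - c n θ) ≤ ∑' n, a n := by
      rw [← (ha.summable_fr _).tsum_add (ha.summable_fr _)]
      refine ((ha.summable_fr _).add (ha.summable_fr _)).tsum_le_tsum (fun n => ?_) ha.summable
      have := fr_add_fr_neg_le (c n θ - (x : T1))
      rw [neg_sub] at this
      nlinarith [ha.pos n]
    rw [mem_ofPred_eq]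
    linarith
  have := hcl2.closure_subset_iff.2 hsub
  rw [closure_Iio] at this
  exact this self_mem_Iic

/-- The height as a continuous function on the blown-up torus. -/
lemma exists_height_function (hc : ∀ n, Continuous (c n)) :
    ∃ σ : T2 → ℝ, Continuous σ ∧ (∀ θ y, IsHeight a c θ (y + (σ (θ, y) : T1)) (σ (θ, y))) ∧
      ∀ θ x s, IsHeight a c θ x s → σ (θ, x - (s : T1)) = s := by
  set K := {p : T2 × ℝ | IsHeight a c p.1.1 p.1.2 p.2} with hK
  have : CompactSpace K := isCompact_iff_compactSpace.1 (ha.isCompact_setOf_isHeight hc)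
  let κ : K → T2 := fun p => (p.1.1.1, p.1.1.2 - (p.1.2 : T1))
  have hcoe : Continuous fun x : ℝ => (x : T1) := AddCircle.continuous_mk' 1
  have hκ : Continuous κ := by fun_prop
  have huniq : ∀ (θ x x' : T1) (s s' : ℝ), IsHeight a c θ x s → IsHeight a c θ x' s' →
      x - (s : T1) = x' - (s' : T1) → s = s' := by
    intro θ x x' s s' h h' he
    have e1 : x = ((fr (x - (s : T1)) + s : ℝ) : T1) := by
      rw [AddCircle.coe_add, coe_fr]; abel
    have e2 : x' = ((fr (x - (s : T1)) + s' : ℝ) : T1) := by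
      rw [AddCircle.coe_add, coe_fr, he]; abel
    rw [e1] at h
    rw [e2] at h'
    exact ha.height_unique h h' (by ring)
  have hinj : Function.Injective κ := by
    rintro ⟨⟨⟨θ, x⟩, s⟩, hp⟩ ⟨⟨⟨θ', x'⟩, s'⟩, hp'⟩ he
    simp only [κ, Prod.mk.injEq] at he
    obtain ⟨rfl, he⟩ := he
    obtain rfl := huniq _ _ _ _ _ hp hp' he
    simpa using he
  have hsurj : Function.Surjective κ := by
    rintro ⟨θ, y⟩
    obtain ⟨x, hx⟩ := ha.exists_height θ (fr y)
    refine ⟨⟨((θ, (x : T1)), x - fr y), hx⟩, ?_⟩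
    simp only [κ, AddCircle.coe_sub, coe_fr, sub_sub_cancel]
  let e : K ≃ₜ T2 := (Continuous.homeoOfEquivCompactToT2
    (f := Equiv.ofBijective κ ⟨hinj, hsurj⟩) hκ)
  have he : ∀ p, e p = κ p := fun p => rfl
  have hes : ∀ z, κ (e.symm z) = z := fun z => by rw [← he, e.apply_symm_apply]
  refine ⟨fun z => (e.symm z).1.2, by fun_prop, fun θ y => ?_, fun θ x s h => ?_⟩
  · have h1 := Prod.mk.inj (hes (θ, y))
    have h2 : IsHeight a c (e.symm (θ, y)).1.1.1 (e.symm (θ, y)).1.1.2 (e.symm (θ, y)).1.2 :=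
      (e.symm (θ, y)).2
    rwa [h1.1, sub_eq_iff_eq_add.1 h1.2] at h2
  · have h1 : e ⟨((θ, x), s), h⟩ = (θ, x - (s : T1)) := rfl
    simp only [← h1, e.symm_apply_apply]

end IsWeight

/-! ### Smoothed saw-tooth functions -/

/-- Height at which the smoothed jump along the `n`-th curve starts. -/
noncomputable def lowSum (a : ℤ → ℝ) (c : ℤ → T1 → T1) (n : ℤ) (θ : T1) : ℝ :=
  ∑' m, a m * lowerLift (c n - c m) θ

/-- Height at which the smoothed jump along the `n`-th curve ends. -/
noncomputable def uppSum (a : ℤ → ℝ) (c : ℤ → T1 → T1) (n : ℤ) (θ : T1) : ℝ :=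
  ∑' m, a m * (1 - lowerLift (c m - c n) θ)

/-- The smoothed step across the gap along the `n`-th curve. -/
noncomputable def gapStep (a : ℤ → ℝ) (c : ℤ → T1 → T1) (n : ℤ) (p : T2 × ℝ) : ℝ :=
  max 0 (min 1 ((p.2 - lowSum a c n p.1.1) / (uppSum a c n p.1.1 - lowSum a c n p.1.1)))

/-- The saw-tooth function with its jump along the `n`-th curve replaced by a smoothed step. -/
noncomputable def sawTooth (a : ℤ → ℝ) (c : ℤ → T1 → T1) (n : ℤ) (p : T2 × ℝ) : ℝ :=
  open Classical in if p.1.2 = c n p.1.1 then gapStep a c n p else fr (p.1.2 - c n p.1.1)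

lemma lowerLift_sub_self (g : T1 → T1) (θ : T1) : lowerLift (g - g) θ = 0 :=
  lowerLift_zero_of_le (by simp) (by simp)

lemma exists_source {ι : Type*} {c : ι → T1 → T1} (hc : ∀ n, Continuous (c n)) {θ : T1}
    (X : Finset ι) (hne : X.Nonempty) (hX : ∀ n ∈ X, ∀ m ∈ X, c n θ = c m θ) :
    ∃ x ∈ X, ∀ m ∈ X, distBelow c θ x m ≤ distBelow c θ m x := by
  obtain ⟨x, hx, h⟩ := exists_sink (c := fun n => -c n) (fun n => (hc n).neg) (θ := θ) X hne
    fun n hn m hm => by simp [hX n hn m hm]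
  refine ⟨x, hx, fun m hm => ?_⟩
  have := h m hm
  simp only [distBelow, neg_sub_neg] at this
  exact this

section sawTooth

variable {a : ℤ → ℝ} {c : ℤ → T1 → T1}

lemma gapStep_nonneg (n : ℤ) (p : T2 × ℝ) : 0 ≤ gapStep a c n p := le_max_left _ _

lemma gapStep_le_one (n : ℤ) (p : T2 × ℝ) : gapStep a c n p ≤ 1 :=
  max_le zero_le_one (min_le_left _ _)

lemma fr_le_sawTooth (n : ℤ) (θ x : T1) (s : ℝ) :
    fr (x - c n θ) ≤ sawTooth a c n ((θ, x), s) := by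
  by_cases hx : x = c n θ
  · rw [sawTooth, if_pos hx, sub_eq_zero.2 hx, fr_zero]
    exact gapStep_nonneg n _
  · rw [sawTooth, if_neg hx]

lemma fr_le_one_sub_sawTooth (n : ℤ) (θ x : T1) (s : ℝ) :
    fr (c n θ - x) ≤ 1 - sawTooth a c n ((θ, x), s) := by
  by_cases hx : x = c n θ
  · rw [sawTooth, if_pos hx, sub_eq_zero.2 hx.symm, fr_zero]
    exact sub_nonneg.2 (gapStep_le_one n _)
  · rw [sawTooth, if_neg hx, ← neg_sub x, fr_neg (sub_ne_zero.2 hx)]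

end sawTooth

/-! ### Stacking the smoothed jumps inside a gap -/

namespace IsWeight

variable {a : ℤ → ℝ} (ha : IsWeight a) {c : ℤ → T1 → T1}
include ha

lemma summable_lowerLift (g : ℤ → T1 → T1) (θ : T1) :
    Summable fun m => a m * lowerLift (g m) θ :=
  ha.summable_mul (fun _ => lowerLift_nonneg) fun _ => lowerLift_le_one

lemma summable_one_sub_lowerLift (g : ℤ → T1 → T1) (θ : T1) :
    Summable fun m => a m * (1 - lowerLift (g m) θ) :=
  ha.summable_mul (fun _ => sub_nonneg.2 lowerLift_le_one)
    fun _ => sub_le_self _ lowerLift_nonneg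

/-- Termwise this is `lowerLift_add_neg_le`, and the term $m=n$ contributes $a_n$. It keeps the
denominator of `gapStep` away from zero. -/
lemma add_lowSum_le_uppSum (n : ℤ) (θ : T1) : lowSum a c n θ + a n ≤ uppSum a c n θ := by
  have h1 : ∀ m, 0 ≤ a m * (1 - lowerLift (c m - c n) θ) - a m * lowerLift (c n - c m) θ :=
    fun m => by
      have := lowerLift_add_neg_le (g := c n - c m) (θ := θ)
      rw [neg_sub] at this
      nlinarith [ha.pos m]
  have hs := (ha.summable_one_sub_lowerLift (fun m => c m - c n) θ).sub
    (ha.summable_lowerLift (fun m => c n - c m) θ)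
  have h2 := hs.le_tsum n fun m _ => h1 m
  rw [(ha.summable_one_sub_lowerLift (fun m => c m - c n) θ).tsum_sub
    (ha.summable_lowerLift (fun m => c n - c m) θ), lowerLift_sub_self] at h2
  unfold lowSum uppSum
  linarith

lemma tsum_fr_le_lowSum (n : ℤ) (θ : T1) :
    ∑' m, a m * fr (c n θ - c m θ) ≤ lowSum a c n θ :=
  (ha.summable_fr _).tsum_le_tsum
    (fun m => mul_le_mul_of_nonneg_left (fr_le_lowerLift (g := c n - c m)) (ha.pos m).le)
    (ha.summable_lowerLift _ θ)

lemma uppSum_le (n : ℤ) (θ : T1) :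
    ∑' m, a m * fr (c m θ - c n θ) ≤ ∑' m, a m - uppSum a c n θ := by
  unfold uppSum
  rw [← ha.summable.tsum_sub (ha.summable_one_sub_lowerLift _ θ)]
  refine (ha.summable_fr _).tsum_le_tsum (fun m => ?_)
    (ha.summable.sub (ha.summable_one_sub_lowerLift _ θ))
  have := fr_le_lowerLift (g := c m - c n) (θ := θ)
  rw [Pi.sub_apply] at this
  nlinarith [ha.pos m]

/-- Going up from $c_n(\theta)$ to $x$, every tooth grows at most by the length of the arc. So just
above the curve heights barely exceed the start of its step. -/
lemma height_le_lowSum_add {n : ℤ} {θ x : T1} {s : ℝ} (h : IsHeight a c θ x s)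
    (hx : x ≠ c n θ) : s ≤ lowSum a c n θ + (∑' m, a m) * fr (x - c n θ) := by
  have h1 : ∀ m, 1 - fr (c m θ - x) ≤ lowerLift (c n - c m) θ + fr (x - c n θ) := fun m => by
    have h2 := one_sub_fr_neg_add_le (c n θ - c m θ) (fr_pos.2 (sub_ne_zero.2 hx))
    rw [coe_fr, show -(c n θ - c m θ + (x - c n θ)) = c m θ - x by abel] at h2
    exact h2.trans (by gcongr; exact fr_le_lowerLift (g := c n - c m))
  have h2 : ∑' m, (a m - a m * fr (c m θ - x)) ≤
      ∑' m, (a m * lowerLift (c n - c m) θ + a m * fr (x - c n θ)) := by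
    refine (ha.summable.sub (ha.summable_fr _)).tsum_le_tsum (fun m => ?_)
      ((ha.summable_lowerLift _ θ).add (ha.summable.mul_right _))
    nlinarith [h1 m, ha.pos m]
  rw [ha.summable.tsum_sub (ha.summable_fr _),
    (ha.summable_lowerLift _ θ).tsum_add (ha.summable.mul_right _), tsum_mul_right] at h2
  unfold lowSum
  linarith [h.2]

lemma uppSum_le_height_add {n : ℤ} {θ x : T1} {s : ℝ} (h : IsHeight a c θ x s)
    (hx : x ≠ c n θ) : uppSum a c n θ ≤ s + (∑' m, a m) * fr (c n θ - x) := by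
  have h1 : ∀ m, 1 - lowerLift (c m - c n) θ ≤ fr (x - c m θ) + fr (c n θ - x) := fun m => by
    have h2 := one_sub_fr_neg_add_le (x - c m θ) (fr_pos.2 (sub_ne_zero.2 hx.symm))
    rw [coe_fr, show -(x - c m θ + (c n θ - x)) = c m θ - c n θ by abel] at h2
    refine le_trans ?_ h2
    gcongr
    exact fr_le_lowerLift (g := c m - c n)
  have h2 : ∑' m, a m * (1 - lowerLift (c m - c n) θ) ≤
      ∑' m, (a m * fr (x - c m θ) + a m * fr (c n θ - x)) := by
    refine (ha.summable_one_sub_lowerLift _ θ).tsum_le_tsum (fun m => ?_)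
      ((ha.summable_fr _).add (ha.summable.mul_right _))
    nlinarith [h1 m, ha.pos m]
  rw [(ha.summable_fr _).tsum_add (ha.summable.mul_right _), tsum_mul_right] at h2
  unfold uppSum
  linarith [h.1]

/-- Just above the curve the step is close to 0, like the tooth it replaces; the next lemma gives
the value 1 just below. This is why `sawTooth` glues continuously on the set of heights. -/
lemma gapStep_le {n : ℤ} {θ x : T1} {s : ℝ} (h : IsHeight a c θ x s) (hx : x ≠ c n θ) :
    gapStep a c n ((θ, x), s) ≤ (∑' m, a m) / a n * fr (x - c n θ) := by
  have h1 := ha.height_le_lowSum_add h hx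
  have h2 := ha.add_lowSum_le_uppSum (c := c) n θ
  have hA := ha.tsum_pos
  have hf := fr_nonneg (x - c n θ)
  have han := ha.pos n
  refine max_le (by positivity) (min_le_of_right_le ?_)
  rw [div_mul_eq_mul_div, div_le_div_iff₀ (by simp only; linarith) han]
  have h3 : s - lowSum a c n θ ≤ (∑' m, a m) * fr (x - c n θ) := by linarith
  have h4 : 0 ≤ (∑' m, a m) * fr (x - c n θ) := by positivity
  simp only
  nlinarith

lemma one_sub_gapStep_le {n : ℤ} {θ x : T1} {s : ℝ} (h : IsHeight a c θ x s) (hx : x ≠ c n θ) :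
    1 - gapStep a c n ((θ, x), s) ≤ (∑' m, a m) / a n * fr (c n θ - x) := by
  have h1 := ha.uppSum_le_height_add h hx
  have h2 := ha.add_lowSum_le_uppSum (c := c) n θ
  have hA := ha.tsum_pos
  have hf := fr_nonneg (c n θ - x)
  have han := ha.pos n
  have h4 : 0 ≤ (∑' m, a m) * fr (c n θ - x) := by positivity
  rw [sub_le_comm]
  refine le_max_of_le_right (le_min (by rw [sub_le_self_iff]; positivity) ?_)
  have hd : 0 < uppSum a c n θ - lowSum a c n θ := by linarith
  simp only
  rw [le_div_iff₀ hd, div_mul_eq_mul_div, sub_mul, one_mul, sub_le_comm, div_mul_eq_mul_div,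
    le_div_iff₀ han]
  nlinarith

lemma continuous_gapStep (hc : ∀ n, Continuous (c n)) (hs : ∀ n m, OneSidedZeros (c n - c m))
    (n : ℤ) : Continuous (gapStep a c n) := by
  have hk : ∀ n m, Continuous (lowerLift (c n - c m)) := fun n m =>
    continuous_lowerLift ((hc n).sub (hc m)) (hs n m)
  have h1 : Continuous (lowSum a c n) :=
    ha.continuous_tsum (C := 1) (fun m => hk n m) fun m θ => by
      rw [abs_of_nonneg lowerLift_nonneg]; exact lowerLift_le_one
  have h2 : Continuous (uppSum a c n) :=
    ha.continuous_tsum (C := 1) (fun m => continuous_const.sub (hk m n)) fun m θ => by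
      rw [abs_of_nonneg (sub_nonneg.2 lowerLift_le_one)]
      exact sub_le_self _ lowerLift_nonneg
  have h3 : ∀ p : T2 × ℝ, uppSum a c n p.1.1 - lowSum a c n p.1.1 ≠ 0 := fun p => by
    have := ha.add_lowSum_le_uppSum (c := c) n p.1.1
    have := ha.pos n
    apply ne_of_gt; linarith
  unfold gapStep
  exact continuous_const.max (continuous_const.min
    (Continuous.div (by fun_prop) (by fun_prop) h3))

lemma abs_sawTooth_sub_gapStep_le {n : ℤ} {θ x : T1} {s : ℝ} (h : IsHeight a c θ x s) :
    |sawTooth a c n ((θ, x), s) - gapStep a c n ((θ, x), s)| ≤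
      (1 + (∑' m, a m) / a n) * ‖x - c n θ‖ := by
  have hA : 0 < (∑' m, a m) / a n := div_pos ha.tsum_pos (ha.pos n)
  by_cases hx : x = c n θ
  · simp [sawTooth, hx]
  · rw [sawTooth, if_neg hx]
    simp only
    have h1 := ha.gapStep_le h hx
    have h2 := ha.one_sub_gapStep_le h hx
    have h3 := gapStep_nonneg (a := a) (c := c) n ((θ, x), s)
    have h4 := gapStep_le_one (a := a) (c := c) n ((θ, x), s)
    have h5 := fr_neg (sub_ne_zero.2 hx)
    rw [neg_sub] at h5
    rw [h5] at h2
    have h6 := fr_nonneg (x - c n θ)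
    have h7 := fr_lt_one (x - c n θ)
    rw [norm_eq_min_fr, abs_le]
    rcases le_total (fr (x - c n θ)) (1 - fr (x - c n θ)) with h | h
    · rw [min_eq_left h]
      constructor <;> nlinarith
    · rw [min_eq_right h]
      constructor <;> nlinarith

lemma continuousOn_sawTooth (hc : ∀ n, Continuous (c n))
    (hs : ∀ n m, OneSidedZeros (c n - c m)) (n : ℤ) :
    ContinuousOn (sawTooth a c n) {p | IsHeight a c p.1.1 p.1.2 p.2} := by
  rintro ⟨⟨θ, x⟩, s⟩ hp
  have hd : Continuous fun p : T2 × ℝ => p.1.2 - c n p.1.1 := by have := hc n; fun_prop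
  by_cases hx : x = c n θ
  · have h0 : sawTooth a c n ((θ, x), s) = gapStep a c n ((θ, x), s) := if_pos hx
    have hw := (ha.continuous_gapStep hc hs n).continuousWithinAt
      (s := {p | IsHeight a c p.1.1 p.1.2 p.2}) (x := ((θ, x), s))
    have hz : Tendsto (fun p : T2 × ℝ => (1 + (∑' m, a m) / a n) * ‖p.1.2 - c n p.1.1‖)
        (𝓝[{p | IsHeight a c p.1.1 p.1.2 p.2}] ((θ, x), s)) (𝓝 0) := by
      have hm : Continuous fun p : T2 × ℝ => (1 + (∑' m, a m) / a n) * ‖p.1.2 - c n p.1.1‖ :=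
        continuous_const.mul hd.norm
      have := hm.continuousWithinAt (s := {p | IsHeight a c p.1.1 p.1.2 p.2})
        (x := ((θ, x), s))
      rwa [ContinuousWithinAt, sub_eq_zero.2 hx, norm_zero, mul_zero] at this
    have hdiff := squeeze_zero_norm' (f := fun p => sawTooth a c n p - gapStep a c n p)
      (eventually_of_mem self_mem_nhdsWithin
        fun p hp => ha.abs_sawTooth_sub_gapStep_le (n := n) hp) hz
    have := hdiff.add hw
    rw [ContinuousWithinAt, h0]
    simp only [sub_add_cancel, zero_add] at this
    exact this
  · have hne : x - c n θ ≠ 0 := sub_ne_zero.2 hx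
    refine ContinuousAt.continuousWithinAt ?_
    refine ContinuousAt.congr (f := fun p : T2 × ℝ => fr (p.1.2 - c n p.1.1))
      (ContinuousAt.comp (f := fun p : T2 × ℝ => p.1.2 - c n p.1.1) (continuousAt_fr hne)
        hd.continuousAt) ?_
    filter_upwards [hd.continuousAt.eventually_ne hne] with p hp
    exact (if_neg (sub_ne_zero.1 hp)).symm

/-- The steps along the curves through a point of a gap cover the gap. -/
lemma exists_lowSum_lt (hc : ∀ n, Continuous (c n)) {θ x : T1} {s s' : ℝ}
    (h : IsHeight a c θ x s) (h' : IsHeight a c θ x s') (hss : s' < s) :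
    ∃ n, x = c n θ ∧ lowSum a c n θ < s ∧ s' < uppSum a c n θ := by
  classical
  by_contra hcon
  push Not at hcon
  -- The weights outside `F` total less than $s-s'$, so they cannot bridge the uncovered interval.
  obtain ⟨F, hF⟩ : ∃ F : Finset ℤ, ∑' n, a n - (s - s') < ∑ n ∈ F, a n :=
    by
    have ht : Tendsto (fun F : Finset ℤ => ∑ n ∈ F, a n) atTop (𝓝 (∑' n, a n)) :=
      ha.summable.hasSum
    exact (ht.eventually_const_lt (sub_lt_self _ (sub_pos.2 hss))).exists
  set M := F.filter fun n => x = c n θ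
  -- If the interval is uncovered, each step of a curve in `F` through $x$ either starts at or above
  -- $s$ (`X`) or ends at or below $s'$ (`Y`).
  set X := M.filter fun n => s ≤ lowSum a c n θ
  set Y := M.filter fun n => ¬ s ≤ lowSum a c n θ
  have hM : ∀ n ∈ F, x = c n θ → n ∈ X ∨ n ∈ Y := fun n hn hx => by
    by_cases hX : s ≤ lowSum a c n θ
    · exact Or.inl (Finset.mem_filter.2 ⟨Finset.mem_filter.2 ⟨hn, hx⟩, hX⟩)
    · exact Or.inr (Finset.mem_filter.2 ⟨Finset.mem_filter.2 ⟨hn, hx⟩, hX⟩)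
  have hXc : ∀ n ∈ X, x = c n θ := fun n hn =>
    (Finset.mem_filter.1 (Finset.mem_filter.1 hn).1).2
  have hYc : ∀ n ∈ Y, x = c n θ := fun n hn =>
    (Finset.mem_filter.1 (Finset.mem_filter.1 hn).1).2
  have hind : ∀ T : Finset ℤ, HasSum (fun m => if m ∈ T then a m else 0) (∑ m ∈ T, a m) :=
    fun T => by
      have h1 : ∑ m ∈ T, a m = ∑ m ∈ T, if m ∈ T then a m else 0 :=
        Finset.sum_congr rfl fun m hm => (if_pos hm).symm
      rw [h1]
      exact hasSum_sum_of_ne_finset_zero fun m hm => if_neg hm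
  have hB := (ha.summable_fr fun m => x - c m θ).hasSum
  set B := ∑' m, a m * fr (x - c m θ)
  have hup := (hB.add (hind Y)).add (ha.summable.hasSum.sub (hind F))
  have hlow := hB.add (hind Y)
  have h1 : s ≤ B + ∑ m ∈ Y, a m + (∑' m, a m - ∑ m ∈ F, a m) := by
    rcases X.eq_empty_or_nonempty with hX | hX
    · have hs := ha.summable.hasSum.sub (ha.summable_fr fun m => c m θ - x).hasSum
      have : s ≤ ∑' m, a m - ∑' m, a m * fr (c m θ - x) := by linarith [h.2]
      refine this.trans (hasSum_le (fun m => ?_) hs hup)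
      have hpos := ha.pos m
      have hf := fr_nonneg (c m θ - x)
      have hf' := fr_nonneg (x - c m θ)
      by_cases hx : x = c m θ
      · by_cases hmF : m ∈ F
        · have hmY : m ∈ Y := (hM m hmF hx).resolve_left (by simp [hX])
          simp only [hmF, hmY, if_true]
          nlinarith
        · simp only [hmF, if_false]
          split_ifs <;> nlinarith
      · rw [← neg_sub x, fr_neg (sub_ne_zero.2 hx)]
        split_ifs <;> nlinarith
    -- For a sink the lifts against all members of `X` vanish, so only `Y` and the tail can raise
    -- its starting height above `B`.
    · obtain ⟨n, hn, hsink⟩ := exists_sink hc (θ := θ) X hX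
        fun n hn m hm => (hXc n hn).symm.trans (hXc m hm)
      refine (Finset.mem_filter.1 hn).2.trans
        (hasSum_le (fun m => ?_) (ha.summable_lowerLift (fun m => c n - c m) θ).hasSum hup)
      have hpos := ha.pos m
      have hf' := fr_nonneg (x - c m θ)
      have hk1 := lowerLift_le_one (g := c n - c m) (θ := θ)
      by_cases hx : x = c m θ
      · by_cases hmF : m ∈ F
        · rcases hM m hmF hx with hmX | hmY
          · have hz : lowerLift (c n - c m) θ = 0 := by
              refine lowerLift_zero_of_le ?_ ?_
              · rw [Pi.sub_apply, ← hXc n hn, ← hx, sub_self]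
              · rw [neg_sub]; exact hsink m hmX
            rw [hz]
            simp only [hmF, if_true]
            split_ifs <;> nlinarith
          · simp only [hmF, hmY, if_true]
            nlinarith
        · simp only [hmF, if_false]
          split_ifs <;> nlinarith
      · rw [lowerLift_of_ne (by
          rw [Pi.sub_apply, ← hXc n hn]; exact sub_ne_zero.2 hx), Pi.sub_apply, ← hXc n hn]
        split_ifs <;> nlinarith
  have h2 : B + ∑ m ∈ Y, a m ≤ s' := by
    rcases Y.eq_empty_or_nonempty with hY | hY
    · rw [hY, Finset.sum_empty, add_zero]; exact h'.1
    -- Dually, a source ends its step above all the weights of `Y`.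
    · obtain ⟨n, hn, hsource⟩ := exists_source hc (θ := θ) Y hY
        fun n hn m hm => (hYc n hn).symm.trans (hYc m hm)
      have hn' := hcon n (hYc n hn) (not_le.1 (Finset.mem_filter.1 hn).2)
      refine le_trans (hasSum_le (fun m => ?_) hlow
        (ha.summable_one_sub_lowerLift (fun m => c m - c n) θ).hasSum) hn'
      have hpos := ha.pos m
      have hk1 := lowerLift_le_one (g := c m - c n) (θ := θ)
      by_cases hx : x = c m θ
      · rw [sub_eq_zero.2 hx, fr_zero]
        split_ifs with hmY
        · rw [lowerLift_zero_of_le (g := c m - c n)]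
          · linarith
          · rw [Pi.sub_apply, ← hYc n hn, ← hx, sub_self]
          · rw [neg_sub]; exact hsource m hmY
        · nlinarith
      · have hmY : m ∉ Y := fun hmY => hx (hYc m hmY)
        rw [if_neg hmY, lowerLift_of_ne (by
          rw [Pi.sub_apply, ← hYc n hn]; exact sub_ne_zero.2 (Ne.symm hx)), Pi.sub_apply,
          ← hYc n hn, ← neg_sub x, fr_neg (sub_ne_zero.2 hx)]
        linarith
  linarith

lemma sawTooth_mono (n : ℤ) (θ x : T1) {s s' : ℝ} (hss : s' ≤ s) :
    sawTooth a c n ((θ, x), s') ≤ sawTooth a c n ((θ, x), s) := by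
  unfold sawTooth
  simp only
  split_ifs with hx
  · have := ha.add_lowSum_le_uppSum (c := c) n θ
    have := ha.pos n
    refine max_le_max_left _ (min_le_min_left _ ?_)
    exact div_le_div_of_nonneg_right (by simp only; linarith) (by simp only; linarith)
  · exact le_rfl

lemma exists_sawTooth_lt (hc : ∀ n, Continuous (c n)) {θ x : T1} {s s' : ℝ}
    (h : IsHeight a c θ x s) (h' : IsHeight a c θ x s') (hss : s' < s) :
    ∃ n, sawTooth a c n ((θ, x), s') < sawTooth a c n ((θ, x), s) := by
  obtain ⟨n, hx, h1, h2⟩ := ha.exists_lowSum_lt hc h h' hss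
  have h3 := ha.add_lowSum_le_uppSum (c := c) n θ
  have h4 := ha.pos n
  have hd : 0 < uppSum a c n θ - lowSum a c n θ := by linarith
  refine ⟨n, ?_⟩
  rw [sawTooth, sawTooth, if_pos hx, if_pos hx]
  have e1 : 0 < (s - lowSum a c n θ) / (uppSum a c n θ - lowSum a c n θ) :=
    div_pos (by linarith) hd
  have e2 : (s' - lowSum a c n θ) / (uppSum a c n θ - lowSum a c n θ) < 1 := by
    rw [div_lt_one hd]; linarith
  have e3 : (s' - lowSum a c n θ) / (uppSum a c n θ - lowSum a c n θ) <
      (s - lowSum a c n θ) / (uppSum a c n θ - lowSum a c n θ) :=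
    div_lt_div_of_pos_right (by linarith) hd
  unfold gapStep
  simp only
  refine max_lt (lt_max_of_lt_right (lt_min one_pos e1)) (lt_max_of_lt_right ?_)
  rw [min_eq_right e2.le]
  exact lt_min e2 e3

end IsWeight

/-! ### The orbit of an invariant family of curves -/

section orbit

variable {ω : ℝ} {R : T2 ≃ₜ T2}

lemma zpow_one_add_apply (R : T2 ≃ₜ T2) (n : ℤ) (z : T2) : (R ^ (n + 1)) z = R ((R ^ n) z) := by
  rw [add_comm, zpow_one_add]; rfl

lemma zpow_add_apply (R : T2 ≃ₜ T2) (m n : ℤ) (z : T2) :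
    (R ^ (m + n)) z = (R ^ m) ((R ^ n) z) := by
  rw [zpow_add]; rfl

lemma zpow_apply_fst (hR : ∀ θ x : T1, (R (θ, x)).1 = θ + (ω : T1)) (n : ℤ) (z : T2) :
    ((R ^ n) z).1 = z.1 + n • (ω : T1) := by
  induction n using Int.induction_on with
  | zero => simp
  | succ n ih =>
    rw [zpow_one_add_apply, ← Prod.mk.eta (p := (R ^ (n : ℤ)) z), hR, ih, add_zsmul, one_zsmul,
      add_assoc]
  | pred n ih =>
    have h := hR ((R ^ (-(n : ℤ) - 1)) z).1 ((R ^ (-(n : ℤ) - 1)) z).2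
    rw [Prod.mk.eta, ← zpow_one_add_apply, sub_add_cancel, ih] at h
    rw [sub_zsmul, one_zsmul, ← add_assoc, h, add_neg_cancel_right]

/-- The function whose graph is the `n`-th iterate of the graph of `γ`. -/
noncomputable def curve (ω : ℝ) (R : T2 ≃ₜ T2) (γ : T1 → T1) (n : ℤ) (θ : T1) : T1 :=
  ((R ^ n) (θ - n • (ω : T1), γ (θ - n • (ω : T1)))).2

variable {γ : T1 → T1}

lemma continuous_curve (hγ : Continuous γ) (n : ℤ) : Continuous (curve ω R γ n) := by
  have := (R ^ n).continuous
  unfold curve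
  fun_prop

lemma curve_zero : curve ω R γ 0 = γ := by
  ext θ; simp [curve]

lemma zpow_apply_graph (hR : ∀ θ x : T1, (R (θ, x)).1 = θ + (ω : T1)) (n : ℤ) (θ : T1) :
    (R ^ n) (θ - n • (ω : T1), γ (θ - n • (ω : T1))) = (θ, curve ω R γ n θ) :=
  Prod.ext (by rw [zpow_apply_fst hR, sub_add_cancel]) rfl

lemma iter_graph (hR : ∀ θ x : T1, (R (θ, x)).1 = θ + (ω : T1)) (n : ℤ) :
    iter R n (graph γ) = graph (curve ω R γ n) := by
  ext ⟨θ, x⟩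
  constructor
  · rintro ⟨⟨θ', x'⟩, hx', he⟩
    obtain rfl : x' = γ θ' := hx'
    have h1 := zpow_apply_fst hR n (θ', γ θ')
    simp only at he
    rw [he] at h1
    obtain rfl : θ' = θ - n • (ω : T1) := eq_sub_of_add_eq h1.symm
    rw [zpow_apply_graph hR] at he
    exact (Prod.mk.inj he).2.symm
  · intro h
    obtain rfl : x = curve ω R γ n θ := h
    exact ⟨_, rfl, zpow_apply_graph hR n θ⟩

lemma curve_succ (hR : ∀ θ x : T1, (R (θ, x)).1 = θ + (ω : T1)) (n : ℤ) (θ : T1) :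
    curve ω R γ (n + 1) (θ + (ω : T1)) = (R (θ, curve ω R γ n θ)).2 := by
  rw [← zpow_apply_graph hR, ← zpow_one_add_apply, curve, add_zsmul, one_zsmul,
    add_sub_add_right_eq_sub]

lemma mem_orbitUnion (hR : ∀ θ x : T1, (R (θ, x)).1 = θ + (ω : T1)) {θ x : T1} :
    (θ, x) ∈ orbitUnion R (graph γ) ↔ ∃ n, x = curve ω R γ n θ := by
  simp only [orbitUnion, mem_iUnion, iter_graph hR]
  rfl

/-- Applying $R^m$ moves coincidences of $\Gamma$ with $R^{n-m}(\Gamma)$ to those of the two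
iterates, so flatness against $\Gamma$ alone controls all pairs. -/
lemma curve_eq_curve_iff (hR : ∀ θ x : T1, (R (θ, x)).1 = θ + (ω : T1)) (n m : ℤ) (θ : T1) :
    curve ω R γ n θ = curve ω R γ m θ ↔
      θ - m • (ω : T1) ∈ Prod.fst '' (graph γ ∩ iter R (n - m) (graph γ)) := by
  have h1 : (θ - m • (ω : T1) ∈ Prod.fst '' (graph γ ∩ iter R (n - m) (graph γ))) ↔
      curve ω R γ (n - m) (θ - m • (ω : T1)) = γ (θ - m • (ω : T1)) := by
    rw [iter_graph hR]
    constructor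
    · rintro ⟨⟨θ', x⟩, ⟨hx, hx'⟩, rfl⟩
      exact hx'.symm.trans hx
    · intro h
      exact ⟨(_, γ (θ - m • (ω : T1))), ⟨rfl, h.symm⟩, rfl⟩
  have h2 := zpow_apply_graph (γ := γ) hR (n - m) (θ - m • (ω : T1))
  have h3 : θ - m • (ω : T1) - (n - m) • (ω : T1) = θ - n • (ω : T1) := by
    rw [sub_zsmul]; abel
  rw [h3] at h2
  have h4 : (R ^ m) (θ - m • (ω : T1), curve ω R γ (n - m) (θ - m • (ω : T1))) =
      (θ, curve ω R γ n θ) := by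
    rw [← h2, ← zpow_add_apply, add_sub_cancel, zpow_apply_graph hR]
  have h5 := zpow_apply_graph (γ := γ) hR m θ
  rw [h1]
  constructor
  · intro h
    rw [h, ← h5] at h4
    exact (Prod.mk.inj ((R ^ m).injective h4)).2
  · intro h
    rw [h, h5] at h4
    exact (Prod.mk.inj h4).2.symm

lemma oneSidedZeros_curve_sub (hR : ∀ θ x : T1, (R (θ, x)).1 = θ + (ω : T1)) (hγ : Continuous γ)
    (hflat : ∀ n : ℤ, FlatIntersections (graph γ) (iter R n (graph γ))) (n m : ℤ) :
    OneSidedZeros (curve ω R γ n - curve ω R γ m) := by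
  refine LocallyIntervalCompl.oneSidedZeros
    ((continuous_curve hγ n).sub (continuous_curve hγ m)) ?_
  obtain ⟨S, hS, -, hI, hSU⟩ := hflat (n - m)
  have := (locallyIntervalCompl_sUnion hS hI).preimage_sub (m • (ω : T1))
  convert! this using 1
  ext θ
  rw [mem_ofPred_eq, mem_ofPred_eq, Pi.sub_apply, sub_eq_zero, curve_eq_curve_iff hR, hSU]

end orbit

/-! ### The blow-up -/

lemma isHeight_iff {a : ℤ → ℝ} {c : ℤ → T1 → T1} {θ x : T1} {s : ℝ} : IsHeight a c θ x s ↔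
    s ∈ Icc (∑' n, a n * fr (x - c n θ)) (∑' n, a n - ∑' n, a n * fr (c n θ - x)) :=
  and_congr_right fun _ => le_sub_comm

namespace IsWeight

variable {a : ℤ → ℝ} (ha : IsWeight a) {c : ℤ → T1 → T1}
include ha

/-- The factor is 1 when the $n$-th curve passes through $x$ and 0 otherwise, so the gap length is
the total weight of the curves through the point. -/
lemma tsum_gap_eq (θ x : T1) :
    (∑' n, a n - ∑' n, a n * fr (c n θ - x)) - ∑' n, a n * fr (x - c n θ) =
      ∑' n, a n * (1 - fr (c n θ - x) - fr (x - c n θ)) := by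
  rw [← ha.summable.tsum_sub (ha.summable_fr _),
    ← (ha.summable.sub (ha.summable_fr _)).tsum_sub (ha.summable_fr _)]
  exact tsum_congr fun n => by ring

lemma bot_le_top (θ x : T1) :
    ∑' n, a n * fr (x - c n θ) ≤ ∑' n, a n - ∑' n, a n * fr (c n θ - x) := by
  rw [← sub_nonneg, ha.tsum_gap_eq]
  refine tsum_nonneg fun n => mul_nonneg (ha.pos n).le ?_
  have := fr_add_fr_neg_le (c n θ - x)
  rw [neg_sub] at this
  linarith

lemma bot_lt_top {θ x : T1} {m : ℤ} (hx : x = c m θ) :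
    ∑' n, a n * fr (x - c n θ) < ∑' n, a n - ∑' n, a n * fr (c n θ - x) := by
  have h : ∀ n, 0 ≤ 1 - fr (c n θ - x) - fr (x - c n θ) := fun n => by
    have := fr_add_fr_neg_le (c n θ - x)
    rw [neg_sub] at this
    linarith
  rw [← sub_pos, ha.tsum_gap_eq]
  refine Summable.tsum_pos (ha.summable_mul h fun n => ?_)
    (fun n => mul_nonneg (ha.pos n).le (h n)) m ?_
  · linarith [fr_nonneg (c n θ - x), fr_nonneg (x - c n θ)]
  · rw [← hx, sub_self, fr_zero]; simpa using ha.pos m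

lemma bot_eq_top {θ x : T1} (hx : ∀ n, x ≠ c n θ) :
    ∑' n, a n - ∑' n, a n * fr (c n θ - x) = ∑' n, a n * fr (x - c n θ) := by
  rw [← sub_eq_zero, ha.tsum_gap_eq]
  refine (tsum_congr fun n => ?_).trans tsum_zero
  rw [← neg_sub x, fr_neg (sub_ne_zero.2 (hx n))]; ring

/-- The displacement of the blown-up map. -/
lemma isDisplacement_blowUp {ψ : T2 → ℝ} (hψ : IsDisplacement ψ) (hc : ∀ n, Continuous (c n))
    (hs : ∀ n m, OneSidedZeros (c n - c m)) {σ : T2 → ℝ} (hσ : Continuous σ)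
    (hσK : ∀ θ y, IsHeight a c θ (y + (σ (θ, y) : T1)) (σ (θ, y))) :
    IsDisplacement fun z => σ z + ψ (z.1, z.2 + (σ z : T1)) - ∑' n, a (n + 1) *
      (sawTooth a c n ((z.1, z.2 + (σ z : T1)), σ z) + ψ (z.1, z.2 + (σ z : T1))
        - ψ (z.1, c n z.1)) := by
  have hcoe : Continuous fun x : ℝ => (x : T1) := AddCircle.continuous_mk' 1
  have hψc := hψ.continuous
  -- By `fr_add_coe`, off the curve this is the tooth of the image curve at the image point; on the
  -- curve it is the smoothed step.
  set v : ℤ → T1 → T1 → ℝ → ℝ := fun n θ x s =>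
    sawTooth a c n ((θ, x), s) + ψ (θ, x) - ψ (θ, c n θ) with hv
  have hlow : ∀ n θ x s, fr (x + (ψ (θ, x) : T1) - (c n θ + (ψ (θ, c n θ) : T1))) ≤ v n θ x s :=
    fun n θ x s => by
      rw [hψ.fr_add_coe]
      linarith [fr_le_sawTooth (a := a) (c := c) n θ x s]
  have hupp : ∀ n θ x s, fr (c n θ + (ψ (θ, c n θ) : T1) - (x + (ψ (θ, x) : T1))) ≤
      1 - v n θ x s := fun n θ x s => by
    rw [hψ.fr_add_coe]
    linarith [fr_le_one_sub_sawTooth (a := a) (c := c) n θ x s]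
  have hv0 : ∀ n θ x s, 0 ≤ v n θ x s := fun n θ x s => (fr_nonneg _).trans (hlow n θ x s)
  have hv1 : ∀ n θ x s, v n θ x s ≤ 1 := fun n θ x s => by
    linarith [(fr_nonneg _).trans (hupp n θ x s)]
  have hsum : ∀ θ x s, Summable fun n => a (n + 1) * v n θ x s := fun θ x s =>
    ha.shift.summable_mul (fun n => hv0 n θ x s) fun n => hv1 n θ x s
  refine ⟨?_, fun θ y y' hyy => ?_⟩
  · refine Continuous.sub (by fun_prop) (ha.shift.continuous_tsum (C := 1) (fun n => ?_)
      fun n z => ?_)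
    · have := hc n
      have h1 : Continuous fun z : T2 => sawTooth a c n ((z.1, z.2 + (σ z : T1)), σ z) :=
        (ha.continuousOn_sawTooth hc hs n).comp_continuous (by fun_prop) fun z => hσK z.1 z.2
      fun_prop
    · rw [abs_of_nonneg (hv0 n _ _ _)]; exact hv1 n _ _ _
  · set s := σ (θ, (y : T1)) with hsdef
    set s' := σ (θ, (y' : T1)) with hsdef'
    have hK : IsHeight a c θ ((y + s : ℝ) : T1) s := by
      rw [AddCircle.coe_add]; exact hσK θ y
    have hK' : IsHeight a c θ ((y' + s' : ℝ) : T1) s' := by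
      rw [AddCircle.coe_add]; exact hσK θ y'
    have hle : y + s ≤ y' + s' := by
      by_contra hlt
      rw [not_le] at hlt
      have := ha.height_sub_le hK' hK hlt
      nlinarith [ha.lt_one]
    simp only [← hsdef, ← hsdef', ← AddCircle.coe_add]
    change y + (s + ψ (θ, ((y + s : ℝ) : T1)) - ∑' n, a (n + 1) * v n θ ((y + s : ℝ) : T1) s) <
      y' + (s' + ψ (θ, ((y' + s' : ℝ) : T1)) - ∑' n, a (n + 1) * v n θ ((y' + s' : ℝ) : T1) s')
    -- If the projected point moves, its image advances by `E` while the new height grows by at most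
    -- `E` times a sum of weights below 1. If both points lie in one gap, $s$ drops, and some step
    -- drops strictly because the steps cover the gap.
    rcases hle.lt_or_eq with hlt | heq
    · have hE := hψ.strictMono θ hlt
      simp only at hE
      set E := (y' + s' + ψ (θ, ((y' + s' : ℝ) : T1))) - (y + s + ψ (θ, ((y + s : ℝ) : T1)))
        with hEdef
      have hEpos : 0 < E := by linarith
      have hadd : ∀ t u : ℝ, ((t + u : ℝ) : T1) = (t : T1) + (u : T1) := fun _ _ => rfl
      have h1 : ∀ n, v n θ ((y' + s' : ℝ) : T1) s' ≤ v n θ ((y + s : ℝ) : T1) s + E := fun n => by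
        have e1 := one_sub_fr_neg_add_le (((y + s : ℝ) : T1) + (ψ (θ, ((y + s : ℝ) : T1)) : T1)
          - (c n θ + (ψ (θ, c n θ) : T1))) hEpos
        rw [show -(((y + s : ℝ) : T1) + (ψ (θ, ((y + s : ℝ) : T1)) : T1)
          - (c n θ + (ψ (θ, c n θ) : T1)) + (E : T1)) = c n θ + (ψ (θ, c n θ) : T1) -
          (((y' + s' : ℝ) : T1) + (ψ (θ, ((y' + s' : ℝ) : T1)) : T1)) by
            rw [hEdef, AddCircle.coe_sub, hadd (y + s), hadd (y' + s')]
            abel] at e1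
        linarith [hlow n θ ((y + s : ℝ) : T1) s, hupp n θ ((y' + s' : ℝ) : T1) s']
      have h2 : ∑' n, a (n + 1) * v n θ ((y' + s' : ℝ) : T1) s' ≤
          ∑' n, (a (n + 1) * v n θ ((y + s : ℝ) : T1) s + a (n + 1) * E) :=
        (hsum _ _ _).tsum_le_tsum (fun n => by nlinarith [h1 n, ha.pos (n + 1)])
          ((hsum _ _ _).add (ha.shift.summable.mul_right _))
      rw [(hsum _ _ _).tsum_add (ha.shift.summable.mul_right _), tsum_mul_right] at h2
      have h3 := ha.shift.lt_one
      nlinarith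
    · have hss : s' < s := by linarith
      rw [← heq] at hK' ⊢
      obtain ⟨m, hm⟩ := ha.exists_sawTooth_lt hc hK hK' hss
      have h1 : ∑' n, a (n + 1) * v n θ ((y + s : ℝ) : T1) s' <
          ∑' n, a (n + 1) * v n θ ((y + s : ℝ) : T1) s := by
        refine Summable.tsum_lt_tsum (i := m) (fun n => ?_) ?_ (hsum _ _ _) (hsum _ _ _)
        · refine mul_le_mul_of_nonneg_left ?_ (ha.pos (n + 1)).le
          have := ha.sawTooth_mono (c := c) n θ ((y + s : ℝ) : T1) hss.le
          simp only [hv]; linarith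
        · refine mul_lt_mul_of_pos_left ?_ (ha.pos (m + 1))
          simp only [hv]; linarith
      linarith

/-- The semiconjugacy holds because the transported height τ lies, term by term, between the lower
and upper saw-tooth values at $R(\theta,x)$; hence it is a height there, and $\pi$ returns the image
point. -/
lemma exists_isBlowUp {ω : ℝ} (hω : Irrational ω) {R : T2 ≃ₜ T2} {ψ : T2 → ℝ}
    (hψ : IsDisplacement ψ) (hRψ : ∀ z, R z = (z.1 + (ω : T1), z.2 + (ψ z : T1)))
    (hc : ∀ n, Continuous (c n)) (hs : ∀ n m, OneSidedZeros (c n - c m))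
    (hrec : ∀ n θ, c (n + 1) (θ + (ω : T1)) = c n θ + (ψ (θ, c n θ) : T1)) {Ξ : Set T2}
    (hΞ : ∀ θ x, (θ, x) ∈ Ξ ↔ ∃ n, x = c n θ) :
    ∃ (π : T2 → T2) (f : T2 ≃ₜ T2), IsBlowUp ω R Ξ π f := by
  have hcoe : Continuous fun x : ℝ => (x : T1) := AddCircle.continuous_mk' 1
  obtain ⟨σ, hσ, hσK, hσu⟩ := ha.exists_height_function hc
  obtain ⟨f, hf, hfz⟩ := (ha.isDisplacement_blowUp hψ hc hs hσ hσK).exists_isQpf hω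
  set π : T2 → T2 := fun z => (z.1, z.2 + (σ z : T1)) with hπ
  have hπc : Continuous π := by fun_prop
  have hπh : ∀ {θ x : T1} {s : ℝ}, IsHeight a c θ x s → π (θ, x - (s : T1)) = (θ, x) :=
    fun {θ x s} h => by simp only [hπ, hσu θ x s h, sub_add_cancel]
  have hpre : ∀ θ x : T1, π ⁻¹' {(θ, x)} = {θ} ×ˢ
      ((fun t : ℝ => (t : T1)) '' Icc (fr x - (∑' n, a n - ∑' n, a n * fr (c n θ - x)))
        (fr x - ∑' n, a n * fr (x - c n θ))) := by
    intro θ x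
    ext ⟨θ', y⟩
    simp only [mem_preimage, mem_singleton_iff, mem_prod, mem_image]
    constructor
    · intro h
      obtain ⟨rfl, rfl⟩ := Prod.mk.inj h
      refine ⟨rfl, fr (y + (σ (θ', y) : T1)) - σ (θ', y), ?_, ?_⟩
      · have := isHeight_iff.1 (hσK θ' y)
        exact ⟨by linarith [this.2], by linarith [this.1]⟩
      · rw [AddCircle.coe_sub, coe_fr, add_sub_cancel_right]
    · rintro ⟨rfl, t, ht, rfl⟩
      have h : IsHeight a c θ' x (fr x - t) :=
        isHeight_iff.2 ⟨by linarith [ht.2], by linarith [ht.1]⟩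
      have := hπh h
      rwa [AddCircle.coe_sub, coe_fr, sub_sub_cancel] at this
  refine ⟨π, f, hπc, ?_, fun θ x => rfl, hf, fun θ => ?_, fun θ x hx => ?_, fun θ x hx => ?_,
    fun z => ?_, ?_⟩
  · rintro ⟨θ, x⟩
    exact ⟨_, hπh (isHeight_iff.2 (left_mem_Icc.2 (ha.bot_le_top θ x)))⟩
  · refine ⟨fun t => t + σ (θ, (t : T1)), by fun_prop, fun t t' htt => ?_, fun t => ?_,
      fun t => by simp only [hπ, AddCircle.coe_add]⟩
    · by_contra hlt
      rw [not_le] at hlt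
      have hK := hσK θ (t : T1)
      have hK' := hσK θ (t' : T1)
      rw [← AddCircle.coe_add] at hK hK'
      have := ha.height_sub_le hK' hK hlt
      simp only at hlt
      nlinarith [ha.lt_one]
    · simp only [AddCircle.coe_add, coe_one, add_zero]; ring
  · obtain ⟨n, hn⟩ := (hΞ θ x).1 hx
    refine ⟨_, ⟨_, ordConnected_Icc, ?_, rfl⟩, hpre θ x⟩
    have := ha.bot_lt_top hn
    exact (infinite_coe_iff.1 (Icc.infinite (by linarith))).nontrivial
  · rw [hΞ, not_exists] at hx
    refine ⟨(θ, ((fr x - ∑' n, a n * fr (x - c n θ) : ℝ) : T1)), ?_⟩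
    rw [hpre, ha.bot_eq_top hx, Icc_self, image_singleton, singleton_prod_singleton]
  · obtain ⟨θ, y⟩ := z
    set x := y + (σ (θ, y) : T1) with hx
    set τ := ∑' n, a (n + 1) * (sawTooth a c n ((θ, x), σ (θ, y)) + ψ (θ, x) - ψ (θ, c n θ))
      with hτ
    have hfzy : f (θ, y) = (θ + (ω : T1), (x + (ψ (θ, x) : T1)) - (τ : T1)) := by
      rw [hfz]
      simp only [AddCircle.coe_sub, AddCircle.coe_add, ← hx, ← hτ]
      rw [Prod.mk.injEq]
      refine ⟨rfl, ?_⟩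
      rw [← add_sub_assoc, ← add_assoc, ← hx]
    have hR : R (π (θ, y)) = (θ + (ω : T1), x + (ψ (θ, x) : T1)) := hRψ _
    rw [hfzy, hR]
    refine hπh ?_
    have hlow : ∀ n, fr (x + (ψ (θ, x) : T1) - (c n θ + (ψ (θ, c n θ) : T1))) ≤
        sawTooth a c n ((θ, x), σ (θ, y)) + ψ (θ, x) - ψ (θ, c n θ) := fun n => by
      rw [hψ.fr_add_coe]
      linarith [fr_le_sawTooth (a := a) (c := c) n θ x (σ (θ, y))]
    have hupp : ∀ n, fr (c n θ + (ψ (θ, c n θ) : T1) - (x + (ψ (θ, x) : T1))) ≤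
        1 - (sawTooth a c n ((θ, x), σ (θ, y)) + ψ (θ, x) - ψ (θ, c n θ)) := fun n => by
      rw [hψ.fr_add_coe]
      linarith [fr_le_one_sub_sawTooth (a := a) (c := c) n θ x (σ (θ, y))]
    have hshift : ∀ g : ℤ → ℝ, ∑' n, g n = ∑' n, g (n + 1) := fun g =>
      ((Equiv.addRight (1 : ℤ)).tsum_eq g).symm
    have hsumτ : Summable fun n => a (n + 1) *
        (sawTooth a c n ((θ, x), σ (θ, y)) + ψ (θ, x) - ψ (θ, c n θ)) :=
      ha.shift.summable_mul (fun n => (fr_nonneg _).trans (hlow n))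
        fun n => by linarith [(fr_nonneg _).trans (hupp n)]
    constructor
    · rw [hshift]
      simp only [hrec]
      exact (ha.shift.summable_fr _).tsum_le_tsum
        (fun n => mul_le_mul_of_nonneg_left (hlow n) (ha.pos _).le) hsumτ
    · rw [hshift, hshift a, hτ, ← ha.shift.summable.tsum_sub hsumτ]
      simp only [hrec]
      refine (ha.shift.summable_fr _).tsum_le_tsum (fun n => ?_) (ha.shift.summable.sub hsumτ)
      nlinarith [hupp n, ha.pos (n + 1)]
  -- Off the curve $c_0$, either the step or one minus the step is at most `B` times the distance to
  -- the curve. So demanding that both exceed this bound is an open condition that forces the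
  -- projection onto $c_0$. The midpoint of the step, where its value is 1/2, satisfies it.
  · set B := (∑' m, a m) / a 0 with hB
    set W : T2 → ℝ := fun z => gapStep a c 0 ((π z), σ z) with hW
    have hWc : Continuous W := (ha.continuous_gapStep hc hs 0).comp (by fun_prop)
    set N : T2 → ℝ := fun z => B * ‖(π z).2 - c 0 z.1‖ with hN
    have hNc : Continuous N := by have := hc 0; fun_prop
    have hopen : IsOpen ({z | N z < W z} ∩ {z | N z < 1 - W z}) :=
      (isOpen_lt hNc hWc).inter (isOpen_lt hNc (continuous_const.sub hWc))
    have hsub : {z | N z < W z} ∩ {z | N z < 1 - W z} ⊆ π ⁻¹' Ξ := by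
      rintro ⟨θ, y⟩ ⟨h1, h2⟩
      rw [mem_preimage, hπ, hΞ]
      refine ⟨0, ?_⟩
      by_contra hne
      have e1 := ha.gapStep_le (hσK θ y) hne
      have e2 := ha.one_sub_gapStep_le (hσK θ y) hne
      simp only [hW, hN, hπ, mem_ofPred_eq] at h1 h2
      rw [← neg_sub (y + (σ (θ, y) : T1)), fr_neg (sub_ne_zero.2 hne)] at e2
      rw [norm_eq_min_fr] at h1 h2
      rcases le_total (fr (y + (σ (θ, y) : T1) - c 0 θ)) (1 - fr (y + (σ (θ, y) : T1) - c 0 θ))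
        with h | h
      · rw [min_eq_left h] at h1
        linarith
      · rw [min_eq_right h] at h2
        linarith
    refine Nonempty.mono (interior_maximal hsub hopen) ?_
    have hgap := ha.add_lowSum_le_uppSum (c := c) 0 0
    have hpos := ha.pos 0
    set s := (lowSum a c 0 0 + uppSum a c 0 0) / 2 with hsdef
    have hH : IsHeight a c 0 (c 0 0) s :=
      ⟨(ha.tsum_fr_le_lowSum 0 0).trans (by linarith),
        (ha.uppSum_le 0 0).trans (by linarith)⟩
    have hd : uppSum a c 0 0 - lowSum a c 0 0 ≠ 0 := by apply ne_of_gt; linarith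
    have hw : gapStep a c 0 ((0, c 0 0), s) = 1 / 2 := by
      have : (s - lowSum a c 0 0) / (uppSum a c 0 0 - lowSum a c 0 0) = 1 / 2 := by
        rw [div_eq_iff hd, hsdef]; ring
      unfold gapStep
      simp only [this]
      norm_num
    refine ⟨(0, c 0 0 - (s : T1)), ?_, ?_⟩
    all_goals
      simp only [hW, hN, mem_ofPred_eq, hπh hH, hσu _ _ _ hH, hw, sub_self, norm_zero, mul_zero]
      norm_num

end IsWeight

lemma exists_isBlowUp {ω : ℝ} {R : T2 ≃ₜ T2} (hR : IsQpf ω R) {γ : T1 → T1} (hγ : Continuous γ)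
    (hflat : ∀ n : ℤ, FlatIntersections (graph γ) (iter R n (graph γ))) :
    ∃ (π : T2 → T2) (f : T2 ≃ₜ T2), IsBlowUp ω R (orbitUnion R (graph γ)) π f := by
  obtain ⟨a, ha⟩ := exists_isWeight
  obtain ⟨ψ, hψ, hRψ⟩ := hR.exists_displacement
  exact ha.exists_isBlowUp hR.1 hψ hRψ (fun n => continuous_curve hγ n)
    (oneSidedZeros_curve_sub hR.2.1 hγ hflat) (fun n θ => by rw [curve_succ hR.2.1, hRψ])
    fun θ x => mem_orbitUnion hR.2.1

/-! ### Transitivity of the blow-up -/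

lemma eq_of_coe_eq_zero {X : Type*} [TopologicalSpace X] [PreconnectedSpace X] {h : X → ℝ}
    (hc : Continuous h) (h0 : ∀ x, (h x : T1) = 0) (x y : X) : h x = h y := by
  have key : ∀ x y, ¬ h x < h y := fun x y hlt => by
    obtain ⟨k, hk⟩ := coe_eq_zero_iff_int.1 (h0 x)
    obtain ⟨l, hl⟩ := coe_eq_zero_iff_int.1 (h0 y)
    have hkl : k + 1 ≤ l := by
      have : (k : ℝ) < l := by rw [hk, hl]; exact hlt
      exact_mod_cast this
    have hkl' : (k : ℝ) + 1 ≤ l := by exact_mod_cast hkl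
    obtain ⟨z, hz⟩ := mem_range_of_exists_le_of_exists_ge hc (c := (k : ℝ) + 1 / 2)
      ⟨x, by rw [← hk]; linarith⟩ ⟨y, by rw [← hl]; linarith⟩
    obtain ⟨m, hm⟩ := coe_eq_zero_iff_int.1 (h0 z)
    rw [hz] at hm
    have h1 : (2 * m : ℝ) = 2 * k + 1 := by linarith
    have h2 : 2 * m = 2 * k + 1 := by exact_mod_cast h1
    omega
  exact le_antisymm (not_lt.1 (key y x)) (not_lt.1 (key x y))

lemma fr_injective : Function.Injective fr := fun z w h => by
  rw [← coe_fr z, h, coe_fr]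

lemma exists_near_mem {O : Set T1} (hO : IsOpen O) {x : T1} (hx : x ∈ O) :
    ∃ ε > 0, ∀ t : ℝ, |t| < ε → x + (t : T1) ∈ O := by
  obtain ⟨ε, hε, h⟩ := Metric.isOpen_iff.1 hO x hx
  refine ⟨ε, hε, fun t ht => h ?_⟩
  rw [Metric.mem_ball, dist_eq_norm, add_sub_cancel_left]
  exact (norm_coe_le t).trans_lt ht

/-- Two graphs which cross over a set are, in a suitable chart of the fibres over a connected
subset, once above and once below each other. -/
lemma CrossOver.exists_chart {γ δ : T1 → T1} (hγ : Continuous γ) {I : Set T1}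
    (h : CrossOver (graph γ) (graph δ) I) :
    ∃ (J : Set ℝ) (o : T1), J.OrdConnected ∧ (∀ s ∈ J, (s : T1) ∈ I) ∧
      (∀ s ∈ J, γ (s : T1) ≠ o ∧ δ (s : T1) ≠ o) ∧
      (∃ s ∈ J, fr (γ (s : T1) - o) < fr (δ (s : T1) - o)) ∧
      ∃ s ∈ J, fr (δ (s : T1) - o) < fr (γ (s : T1) - o) := by
  obtain ⟨I', O, hI'I, ⟨J, hJ, hJn, rfl⟩, -, hO, hOne, hγO, hδO, hcomp⟩ := h
  obtain ⟨o, ho⟩ := (ne_univ_iff_exists_notMem O).1 hOne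
  set I' := (fun t : ℝ => (t : T1)) '' J with hI'
  have hγm : ∀ θ ∈ I', γ θ ∈ O := fun θ hθ => (hγO (a := (θ, γ θ)) ⟨rfl, hθ⟩).2
  have hδm : ∀ θ ∈ I', δ θ ∈ O := fun θ hθ => (hδO (a := (θ, δ θ)) ⟨rfl, hθ⟩).2
  have hne : ∀ x ∈ O, x ≠ o := fun x hx hxo => ho (hxo ▸ hx)
  set F := (I' ×ˢ O) \ graph γ with hF
  set H : T2 → ℝ := fun z => fr (z.2 - o) - fr (γ z.1 - o) with hH
  have hHc : ContinuousOn H F := by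
    intro z hz
    refine ContinuousAt.continuousWithinAt (ContinuousAt.sub ?_ ?_)
    · exact ContinuousAt.comp (f := fun z : T2 => z.2 - o)
        (continuousAt_fr (sub_ne_zero.2 (hne _ hz.1.2))) (by fun_prop)
    · exact ContinuousAt.comp (f := fun z : T2 => γ z.1 - o)
        (continuousAt_fr (sub_ne_zero.2 (hne _ (hγm _ hz.1.1)))) (by fun_prop)
  have hH0 : ∀ z ∈ F, H z ≠ 0 := fun z hz h0 => hz.2 (sub_left_injective
    (fr_injective (sub_eq_zero.1 h0)))
  -- `H` has no zero on `F`, hence constant sign on a component. A graph meeting the component of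
  -- $z$ therefore attains the sign of $z$.
  have hmeet : ∀ z ∈ F, ∃ s ∈ J, 0 < H z * H ((s : T1), δ (s : T1)) := by
    intro z hz
    obtain ⟨⟨θ, x⟩, hw, hwδ⟩ := hcomp z hz
    obtain rfl : x = δ θ := hwδ
    have hwF := connectedComponentIn_subset _ _ hw
    obtain ⟨s, hs, rfl⟩ := hwF.1.1
    refine ⟨s, hs, ?_⟩
    have hpre : IsPreconnected (connectedComponentIn F z) := isPreconnected_connectedComponentIn
    have hz' : z ∈ connectedComponentIn F z := mem_connectedComponentIn hz
    have hcont := hHc.mono (connectedComponentIn_subset F z)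
    have hzero : ∀ p ∈ connectedComponentIn F z, H p ≠ 0 := fun p hp =>
      hH0 p (connectedComponentIn_subset _ _ hp)
    by_contra hle
    rw [not_lt] at hle
    rcases mul_nonpos_iff.1 hle with ⟨h1, h2⟩ | ⟨h1, h2⟩
    · obtain ⟨p, hp, hp0⟩ := hpre.intermediate_value hw hz' hcont ⟨h2, h1⟩
      exact hzero p hp hp0
    · obtain ⟨p, hp, hp0⟩ := hpre.intermediate_value hz' hw hcont ⟨h1, h2⟩
      exact hzero p hp hp0
  obtain ⟨s0, hs0⟩ := hJn.nonempty
  have hs0' : (s0 : T1) ∈ I' := ⟨s0, hs0, rfl⟩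
  obtain ⟨ε, hε, hnear⟩ := exists_near_mem hO (hγm _ hs0')
  set g := fr (γ (s0 : T1) - o) with hg
  have hg0 : 0 < g := fr_pos.2 (sub_ne_zero.2 (hne _ (hγm _ hs0')))
  have hg1 : g < 1 := fr_lt_one _
  have hval : ∀ t : ℝ, 0 ≤ g + t → g + t < 1 → H ((s0 : T1), γ (s0 : T1) + (t : T1)) = t := by
    intro t h0 h1
    have : γ (s0 : T1) + (t : T1) - o = ((g + t : ℝ) : T1) := by
      rw [AddCircle.coe_add, hg, coe_fr]; abel
    simp only [hH, this, fr_of_mem h0 h1, ← hg, add_sub_cancel_left]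
  have hmem : ∀ t : ℝ, |t| < ε → 0 ≤ g + t → g + t < 1 → t ≠ 0 →
      ((s0 : T1), γ (s0 : T1) + (t : T1)) ∈ F := by
    intro t ht h0 h1 hne0
    refine ⟨⟨hs0', hnear t ht⟩, fun hgr => hne0 ?_⟩
    rw [← hval t h0 h1]
    have : γ (s0 : T1) + (t : T1) = γ (s0 : T1) := hgr
    simp only [hH, this, sub_self]
  refine ⟨J, o, hJ, fun s hs => hI'I ⟨s, hs, rfl⟩,
    fun s hs => ⟨hne _ (hγm _ ⟨s, hs, rfl⟩), hne _ (hδm _ ⟨s, hs, rfl⟩)⟩, ?_, ?_⟩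
  -- A test point slightly above γ in one fibre, inside `O` and short of the omitted point `o`; the
  -- other case uses one slightly below.
  · set t := min ε (1 - g) / 2 with ht
    have ht0 : 0 < t := half_pos (lt_min hε (by linarith))
    have ht1 : t < ε := (half_lt_self (lt_min hε (by linarith))).trans_le (min_le_left _ _)
    have ht2 : t < 1 - g := (half_lt_self (lt_min hε (by linarith))).trans_le (min_le_right _ _)
    obtain ⟨s, hs, hpos⟩ := hmeet _ (hmem t (by rwa [abs_of_pos ht0]) (by linarith)
      (by linarith) ht0.ne')
    rw [hval t (by linarith) (by linarith)] at hpos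
    exact ⟨s, hs, sub_pos.1 (pos_of_mul_pos_right hpos ht0.le)⟩
  · set t := min ε g / 2 with ht
    have ht0 : 0 < t := half_pos (lt_min hε hg0)
    have ht1 : t < ε := (half_lt_self (lt_min hε hg0)).trans_le (min_le_left _ _)
    have ht2 : t < g := (half_lt_self (lt_min hε hg0)).trans_le (min_le_right _ _)
    obtain ⟨s, hs, hpos⟩ := hmeet _ (hmem (-t) (by rwa [abs_neg, abs_of_pos ht0]) (by linarith)
      (by linarith) (by linarith))
    rw [hval (-t) (by linarith) (by linarith)] at hpos
    have : H ((s : T1), δ (s : T1)) < 0 := by nlinarith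
    exact ⟨s, hs, sub_neg.1 this⟩

lemma continuousOn_chart {γ : T1 → T1} (hγ : Continuous γ) {J : Set ℝ} {o : T1}
    (h : ∀ s ∈ J, γ (s : T1) ≠ o) : ContinuousOn (fun s : ℝ => fr (γ (s : T1) - o)) J := by
  have hcoe : Continuous fun x : ℝ => (x : T1) := AddCircle.continuous_mk' 1
  exact fun s hs => (ContinuousAt.comp (f := fun s : ℝ => γ (s : T1) - o)
    (continuousAt_fr (sub_ne_zero.2 (h s hs))) (by fun_prop)).continuousWithinAt

lemma CrossOver.exists_eq {γ δ : T1 → T1} (hγ : Continuous γ) (hδ : Continuous δ) {I : Set T1}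
    (h : CrossOver (graph γ) (graph δ) I) : ∃ θ ∈ I, γ θ = δ θ := by
  obtain ⟨J, o, hJ, hJI, hne, ⟨s1, hs1, h1⟩, s2, hs2, h2⟩ := h.exists_chart hγ
  have hc := (continuousOn_chart hδ fun s hs => (hne s hs).2).sub
    (continuousOn_chart hγ fun s hs => (hne s hs).1)
  obtain ⟨s, hs, h0⟩ := hJ.isPreconnected.intermediate_value hs2 hs1 hc
    (show (0 : ℝ) ∈ _ from ⟨(sub_neg.2 h2).le, (sub_pos.2 h1).le⟩)
  exact ⟨s, hJI s hs, (sub_left_injective (fr_injective (sub_eq_zero.1 h0))).symm⟩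

/-- If the images of two continuous sections under a fibrewise increasing map cross over a set,
then the two sections meet over this set. -/
lemma exists_section_eq {π : T2 → T2} (hπ : Continuous π)
    (hinc : ∀ θ : T1, IsIncreasing fun x => (π (θ, x)).2) {γ δ C : T1 → T1}
    (hγ : Continuous γ) (hδ : Continuous δ) (hC : Continuous C) {y : T1} {I : Set T1}
    (hCI : ∀ θ ∈ I, (π (θ, C θ)).2 = δ θ) (hyI : ∀ θ ∈ I, (π (θ, y)).2 = γ θ)
    (h : CrossOver (graph γ) (graph δ) I) : ∃ θ ∈ I, C θ = y := by
  obtain ⟨J, o, hJ, hJI, hne, ⟨s1, hs1, h1⟩, s2, hs2, h2⟩ := h.exists_chart hγ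
  by_contra hcon
  push Not at hcon
  have hcoe : Continuous fun x : ℝ => (x : T1) := AddCircle.continuous_mk' 1
  have : PreconnectedSpace J := Subtype.preconnectedSpace hJ.isPreconnected
  -- If the sections never meet, this displacement is continuous. Scaling it from 0 to 1 contracts
  -- `C` to the constant section, so the displacement of the projected sections has a real lift `G`.
  set d : J → ℝ := fun s => fr (C (s : ℝ) - y) with hd
  have hdc : Continuous d := continuousOn_iff_continuous_domRestrict.1
    (continuousOn_chart hC fun s hs => hcon _ (hJI s hs))
  have hCd : ∀ s : J, y + (d s : T1) = C (s : ℝ) := fun s => by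
    simp only [hd, coe_fr, add_sub_cancel]
  obtain ⟨G, hG, hGl, hG0⟩ := exists_real_lift (X := J)
    (g := fun p => (π (((p.2 : ℝ) : T1), y + (((p.1 : ℝ) * d p.2 : ℝ) : T1))).2 -
      (π (((p.2 : ℝ) : T1), y)).2) (by fun_prop) (fun s => by simp)
  have hG1 : ∀ s : J, (G (1, s) : T1) = δ (s : ℝ) - γ (s : ℝ) := fun s => by
    rw [hGl]
    simp only [Set.Icc.coe_one, one_mul, hCd]
    rw [hCI _ (hJI s s.2), hyI _ (hJI s s.2)]
  -- An increasing degree-one map sends an arc shorter than one turn to an arc of at most one turn.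
  have hGI : ∀ s : J, G (1, s) ∈ Icc (0 : ℝ) 1 := fun s => by
    obtain ⟨P, hPc, hPm, hP1, hP⟩ := hinc ((s : ℝ) : T1)
    have hy : ∀ t : ℝ, (π (((s : ℝ) : T1), y + (t : T1))).2 = (P (fr y + t) : T1) := fun t => by
      rw [← hP, AddCircle.coe_add, coe_fr]
    have hy0 : (π (((s : ℝ) : T1), y)).2 = (P (fr y) : T1) := by rw [← hP, coe_fr]
    have := eq_of_coe_eq_zero (X := unitInterval)
      (h := fun τ => G (τ, s) - (P (fr y + (τ : ℝ) * d s) - P (fr y))) (by fun_prop)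
      (fun τ => by
        rw [AddCircle.coe_sub, AddCircle.coe_sub, hGl]
        simp only [hy, hy0, sub_self]) 1 0
    simp only [hG0, Set.Icc.coe_one, Set.Icc.coe_zero, one_mul, zero_mul, add_zero, sub_self]
      at this
    have e1 := hPm (show fr y ≤ fr y + d s by linarith [fr_nonneg (C (s : ℝ) - y)])
    have e2 := hPm (show fr y + d s ≤ fr y + 1 by linarith [fr_lt_one (C (s : ℝ) - y)])
    rw [hP1] at e2
    exact ⟨by linarith, by linarith⟩
  have hq := continuousOn_iff_continuous_domRestrict.1
    ((continuousOn_chart hδ fun s hs => (hne s hs).2).sub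
      (continuousOn_chart hγ fun s hs => (hne s hs).1))
  -- `G` differs from the difference in the chart by a constant integer. That difference takes both
  -- signs while `G` stays in $[0,1]$, which would put the integer strictly between 0 and 1.
  have hconst := eq_of_coe_eq_zero (X := J)
    (h := fun s => G (1, s) - (fr (δ (s : ℝ) - o) - fr (γ (s : ℝ) - o)))
    ((by fun_prop : Continuous fun s : J => G (1, s)).sub hq) (fun s => by
      rw [AddCircle.coe_sub, AddCircle.coe_sub, hG1, coe_fr, coe_fr]; abel)
  have hint : ∀ s : J, ∃ k : ℤ, (k : ℝ) = G (1, s) - (fr (δ (s : ℝ) - o) - fr (γ (s : ℝ) - o)) :=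
    fun s => coe_eq_zero_iff_int.1 (by
      rw [AddCircle.coe_sub, AddCircle.coe_sub, hG1, coe_fr, coe_fr]; abel)
  have h3 := hconst ⟨s1, hs1⟩ ⟨s2, hs2⟩
  obtain ⟨k, hk⟩ := hint ⟨s1, hs1⟩
  rw [← hk] at h3
  have g1 := hGI ⟨s1, hs1⟩
  have g2 := hGI ⟨s2, hs2⟩
  have k1 : (k : ℝ) < 1 := by linarith [g1.2]
  have k2 : (0 : ℝ) < k := by linarith [g2.1]
  have k1' : k < 1 := by exact_mod_cast k1
  have k2' : 0 < k := by exact_mod_cast k2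
  omega

/-! ### Dynamics of the gaps -/

section transitivity

variable {ω : ℝ} {R f : T2 ≃ₜ T2} {γ : T1 → T1} {π : T2 → T2}

lemma zpow_apply_curve (hR : ∀ θ x : T1, (R (θ, x)).1 = θ + (ω : T1)) (i k : ℤ) (θ : T1) :
    (R ^ k) (θ, curve ω R γ i θ) =
      (θ + k • (ω : T1), curve ω R γ (k + i) (θ + k • (ω : T1))) := by
  have h : θ + k • (ω : T1) - (k + i) • (ω : T1) = θ - i • (ω : T1) := by
    rw [add_zsmul]; abel
  rw [← zpow_apply_graph hR, ← zpow_apply_graph hR, ← zpow_add_apply, h]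

lemma semiconj_zpow (h : ∀ z, π (f z) = R (π z)) (n : ℤ) (z : T2) :
    π ((f ^ n) z) = (R ^ n) (π z) := by
  induction n using Int.induction_on with
  | zero => simp
  | succ n ih => rw [zpow_one_add_apply, zpow_one_add_apply, h, ih]
  | pred n ih =>
    apply R.injective
    rw [← h, ← zpow_one_add_apply, ← zpow_one_add_apply, sub_add_cancel, ih]

/-- The part of the blown-up torus over the `i`-th iterate of the graph. -/
def gapSet (ω : ℝ) (R : T2 ≃ₜ T2) (γ : T1 → T1) (π : T2 → T2) (i : ℤ) : Set T2 :=
  {z | (π z).2 = curve ω R γ i z.1}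

lemma isClosed_gapSet (hγ : Continuous γ) (hπ : Continuous π) (i : ℤ) :
    IsClosed (gapSet ω R γ π i) := by
  have := continuous_curve (ω := ω) (R := R) hγ i
  exact isClosed_eq (by fun_prop) (by fun_prop)

variable (hB : IsBlowUp ω R (orbitUnion R (graph γ)) π f)
  (hR : ∀ θ x : T1, (R (θ, x)).1 = θ + (ω : T1)) (hγ : Continuous γ)
include hB hR

lemma zpow_mem_gapSet {z : T2} {i : ℤ} (hz : z ∈ gapSet ω R γ π i) (k : ℤ) :
    (f ^ k) z ∈ gapSet ω R γ π (k + i) := by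
  have h1 : π z = (z.1, curve ω R γ i z.1) := Prod.ext (hB.fibre z.1 z.2) hz
  have h2 := semiconj_zpow hB.semiconj k z
  rw [h1, zpow_apply_curve hR] at h2
  rw [gapSet, mem_ofPred_eq, h2, zpow_apply_fst hB.qpf.2.1]

lemma zpow_preimage_gapSet {W : Set T2} {i : ℤ} (hW : W ⊆ gapSet ω R γ π i) :
    (fun z => (f ^ i) z) ⁻¹' W ⊆ gapSet ω R γ π 0 := by
  intro z hz
  have := zpow_mem_gapSet hB hR (hW hz) (-i)
  rwa [← zpow_add_apply, neg_add_cancel, zpow_zero] at this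

include hγ

/-- Baire: inside `U`, countably many closed sets, one for each curve, cover everything, so one of
them has interior in `U`. -/
lemma exists_open_subset_gapSet {U : Set T2} (hU : IsOpen U) (hne : U.Nonempty)
    (hsub : U ⊆ π ⁻¹' orbitUnion R (graph γ)) :
    ∃ (W : Set T2) (i : ℤ), IsOpen W ∧ W.Nonempty ∧ W ⊆ U ∧ W ⊆ gapSet ω R γ π i := by
  have hd := dense_iUnion_interior_of_closed (f := fun i => gapSet ω R γ π i ∪ Uᶜ)
    (fun i => (isClosed_gapSet hγ hB.continuous i).union hU.isClosed_compl) (by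
      refine eq_univ_of_forall fun z => mem_iUnion.2 ?_
      by_cases hz : z ∈ U
      · have h1 := hsub hz
        rw [mem_preimage, ← Prod.mk.eta (p := π z), mem_orbitUnion hR, hB.fibre z.1 z.2] at h1
        obtain ⟨i, hi⟩ := h1
        exact ⟨i, Or.inl hi⟩
      · exact ⟨0, Or.inr hz⟩)
  obtain ⟨z, hzU, hz⟩ := hd.inter_open_nonempty U hU hne
  obtain ⟨i, hi⟩ := mem_iUnion.1 hz
  exact ⟨U ∩ interior (gapSet ω R γ π i ∪ Uᶜ), i, hU.inter isOpen_interior, ⟨z, hzU, hi⟩,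
    inter_subset_left, fun w hw => (interior_subset hw.2).resolve_right (not_not.2 hw.1)⟩

/-- Open sets in the gaps over the initial graph meet at arbitrarily late times. -/
lemma exists_iterate_mem_of_gapSet (hT : CrossingProperty ω R (graph γ)) {U V : Set T2}
    (hU : IsOpen U) (hV : IsOpen V) (hUne : U.Nonempty) (hVne : V.Nonempty)
    (hUg : U ⊆ gapSet ω R γ π 0) (hVg : V ⊆ gapSet ω R γ π 0) (N : ℕ) :
    ∃ n : ℕ, N ≤ n ∧ ∃ z ∈ U, (f ^ (n : ℤ)) z ∈ V := by
  have hcoe : Continuous fun x : ℝ => (x : T1) := AddCircle.continuous_mk' 1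
  obtain ⟨⟨θ1, y1⟩, hz1⟩ := hUne
  obtain ⟨⟨θ2', y2⟩, hz2'⟩ := hVne
  obtain ⟨t1, rfl⟩ : ∃ t : ℝ, (t : T1) = θ1 := ⟨fr θ1, coe_fr θ1⟩
  have hfin : ((fun k : ℕ => (t1 : T1) + k • (ω : T1)) '' Iio N).Finite := (finite_Iio N).image _
  have : Nontrivial T1 := ⟨0, ((1 / 2 : ℝ) : T1), fun h => by
    have := fr_of_mem (t := 1 / 2) (by norm_num) (by norm_num)
    rw [← h, fr_zero] at this
    norm_num at this⟩
  have : ConnectedSpace T1 := inferInstance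
  have hVs : IsOpen {θ : T1 | (θ, y2) ∈ V} := hV.preimage (by fun_prop)
  -- Avoiding the first `N` base rotations of `t1` forces any visit between nearby base points to
  -- happen at time at least `N`.
  obtain ⟨θ2, hθ2, hz2⟩ := (dense_univ.sdiff_finite hfin).inter_open_nonempty _ hVs ⟨θ2', hz2'⟩
  obtain ⟨t2, rfl⟩ : ∃ t : ℝ, (t : T1) = θ2 := ⟨fr θ2, coe_fr θ2⟩
  have hev : ∀ᶠ p : ℝ × ℝ in 𝓝 (t1, t2), ((p.1 : T1), y1) ∈ U ∧ ((p.2 : T1), y2) ∈ V ∧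
      ∀ k ∈ Iio N, (p.1 : T1) + k • (ω : T1) ≠ (p.2 : T1) := by
    refine ((hU.preimage (f := fun p : ℝ × ℝ => ((p.1 : T1), y1)) (by fun_prop)).eventually_mem
      hz1).and (((hV.preimage (f := fun p : ℝ × ℝ => ((p.2 : T1), y2))
      (by fun_prop)).eventually_mem hθ2).and ((eventually_all_finite (finite_Iio N)).2 fun k hk => ?_))
    have hop : IsOpen {p : ℝ × ℝ | (p.1 : T1) + k • (ω : T1) ≠ (p.2 : T1)} :=
      isOpen_ne_fun (by fun_prop) (by fun_prop)
    exact hop.eventually_mem fun he => hz2.2 ⟨k, hk, he⟩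
  obtain ⟨ε, hε, hev⟩ := Metric.eventually_nhds_iff.1 hev
  have hnt : ∀ t : ℝ, IsNontrivialInterval ((fun s : ℝ => (s : T1)) '' Ioo (t - ε) (t + ε)) :=
    fun t => ⟨_, ordConnected_Ioo, (Ioo_infinite (by linarith)).nontrivial, rfl⟩
  have hclose : ∀ s ∈ Ioo (t1 - ε) (t1 + ε), ∀ s' ∈ Ioo (t2 - ε) (t2 + ε),
      ((s : T1), y1) ∈ U ∧ ((s' : T1), y2) ∈ V ∧
        ∀ k ∈ Iio N, (s : T1) + k • (ω : T1) ≠ (s' : T1) := fun s hs s' hs' => by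
    refine @hev (s, s') ?_
    rw [← Metric.mem_ball, ← ball_prod_same, Real.ball_eq_Ioo, Real.ball_eq_Ioo]
    exact ⟨hs, hs'⟩
  obtain ⟨n, hn⟩ := hT _ _ (hnt t2) (hnt t1)
  rw [iter_graph hR] at hn
  -- The image under $f^n$ of the horizontal circle at height `y1`; over the crossing set it
  -- projects to the $n$-th curve.
  set C : T1 → T1 := fun θ => ((f ^ (n : ℤ)) (θ - n • (ω : T1), y1)).2 with hC
  have hCc : Continuous C := by
    have := (f ^ (n : ℤ)).continuous
    fun_prop
  have hCf : ∀ θ, (f ^ (n : ℤ)) (θ - n • (ω : T1), y1) = (θ, C θ) := fun θ => by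
    refine Prod.ext ?_ rfl
    rw [zpow_apply_fst hB.qpf.2.1, natCast_zsmul, sub_add_cancel]
  have ht1 : t1 ∈ Ioo (t1 - ε) (t1 + ε) := ⟨by linarith, by linarith⟩
  have ht2 : t2 ∈ Ioo (t2 - ε) (t2 + ε) := ⟨by linarith, by linarith⟩
  have hCI : ∀ θ ∈ (fun s : ℝ => (s : T1)) '' Ioo (t2 - ε) (t2 + ε) ∩
      (fun θ : T1 => θ + n • (ω : T1)) '' ((fun s : ℝ => (s : T1)) '' Ioo (t1 - ε) (t1 + ε)),
      (π (θ, C θ)).2 = curve ω R γ n θ := by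
    rintro θ ⟨-, _, ⟨s, hs, rfl⟩, rfl⟩
    have h1 := hUg (hclose s hs t2 ht2).1
    have h2 := zpow_mem_gapSet hB hR h1 n
    have h3 := hCf ((s : T1) + n • (ω : T1))
    rw [add_sub_cancel_right] at h3
    rwa [h3, add_zero] at h2
  have hyI : ∀ θ ∈ (fun s : ℝ => (s : T1)) '' Ioo (t2 - ε) (t2 + ε) ∩
      (fun θ : T1 => θ + n • (ω : T1)) '' ((fun s : ℝ => (s : T1)) '' Ioo (t1 - ε) (t1 + ε)),
      (π (θ, y2)).2 = γ θ := by
    rintro θ ⟨⟨s', hs', rfl⟩, -⟩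
    have h1 := hVg (hclose t1 ht1 s' hs').2.1
    rwa [gapSet, mem_ofPred_eq, curve_zero] at h1
  obtain ⟨θ, ⟨⟨s', hs', hθ⟩, _, ⟨s, hs, rfl⟩, hs''⟩, he⟩ := exists_section_eq hB.continuous
    hB.increasing hγ (continuous_curve (ω := ω) (R := R) hγ n) hCc hCI hyI hn
  simp only at hθ hs''
  subst hθ
  refine ⟨n, ?_, ((s : T1), y1), (hclose s hs t2 ht2).1, ?_⟩
  · by_contra hlt
    exact (hclose s hs s' hs').2.2 n (not_le.1 hlt) hs''
  · have h1 := hCf (s' : T1)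
    rw [← hs'', add_sub_cancel_right, hs'', he] at h1
    rw [h1]
    exact (hclose t1 ht1 s' hs').2.1

/-- Every open set contains an open set consisting of gaps. -/
lemma exists_open_subset_gapSet_of_dense (hT : CrossingProperty ω R (graph γ))
    (hD : Dense (orbitUnion R (graph γ))) {U : Set T2} (hU : IsOpen U) (hne : U.Nonempty) :
    ∃ (W : Set T2) (i : ℤ), IsOpen W ∧ W.Nonempty ∧ W ⊆ U ∧ W ⊆ gapSet ω R γ π i := by
  by_cases hsub : U ⊆ π ⁻¹' orbitUnion R (graph γ)
  · exact exists_open_subset_gapSet hB hR hγ hU hne hsub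
  have hcoe : Continuous fun x : ℝ => (x : T1) := AddCircle.continuous_mk' 1
  obtain ⟨p, hpU, hp⟩ := not_subset.1 hsub
  -- An open set whose full preimage lies in `U`. It contains $\pi(p)$ because the fibre over a
  -- point outside $\Xi$ is a single point, so density of $\Xi$ puts a point of some curve $c_j$ in
  -- it.
  set O := (π '' Uᶜ)ᶜ with hO
  have hOo : IsOpen O :=
    (hU.isClosed_compl.isCompact.image hB.continuous).isClosed.isOpen_compl
  have hOU : π ⁻¹' O ⊆ U := fun z hz => by
    by_contra hzU
    exact hz ⟨z, hzU, rfl⟩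
  have hpO : π p ∈ O := by
    rintro ⟨z, hzU, hz⟩
    obtain ⟨w, hw⟩ := hB.point (π p).1 (π p).2 hp
    have h1 : z ∈ π ⁻¹' {((π p).1, (π p).2)} := hz
    have h2 : p ∈ π ⁻¹' {((π p).1, (π p).2)} := rfl
    rw [hw] at h1 h2
    exact hzU ((mem_singleton_iff.1 h1).trans (mem_singleton_iff.1 h2).symm ▸ hpU)
  obtain ⟨⟨θ0, x0⟩, hzO, hzΞ⟩ := hD.inter_open_nonempty O hOo ⟨_, hpO⟩
  obtain ⟨j, rfl⟩ := (mem_orbitUnion hR).1 hzΞ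
  obtain ⟨W0, i, hW0, hW0ne, -, hW0g⟩ := exists_open_subset_gapSet hB hR hγ isOpen_interior
    hB.interior interior_subset
  set W1 := (fun z => (f ^ i) z) ⁻¹' W0 with hW1
  have hW1o : IsOpen W1 := hW0.preimage (f ^ i).continuous
  have hW1g : W1 ⊆ gapSet ω R γ π 0 := zpow_preimage_gapSet hB hR hW0g
  obtain ⟨⟨θ1, y1⟩, hz1⟩ : W1.Nonempty := by
    obtain ⟨w, hw⟩ := hW0ne
    exact ⟨(f ^ i).symm w, by simpa [hW1] using hw⟩
  obtain ⟨t1, rfl⟩ : ∃ t : ℝ, (t : T1) = θ1 := ⟨fr θ1, coe_fr θ1⟩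
  obtain ⟨t0, ht0⟩ : ∃ t : ℝ, (t : T1) = θ0 - j • (ω : T1) := ⟨fr _, coe_fr _⟩
  have hcj := continuous_curve (ω := ω) (R := R) hγ j
  have hev : ∀ᶠ p : ℝ × ℝ in 𝓝 (t1, t0), ((p.1 : T1), y1) ∈ W1 ∧
      ((p.2 : T1) + j • (ω : T1), curve ω R γ j ((p.2 : T1) + j • (ω : T1))) ∈ O :=
    ((hW1o.preimage (f := fun p : ℝ × ℝ => ((p.1 : T1), y1)) (by fun_prop)).eventually_mem
      hz1).and ((hOo.preimage (f := fun p : ℝ × ℝ => ((p.2 : T1) + j • (ω : T1),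
        curve ω R γ j ((p.2 : T1) + j • (ω : T1)))) (by fun_prop)).eventually_mem (by
          simp only [mem_preimage, ht0, sub_add_cancel]; exact hzO))
  obtain ⟨ε, hε, hev⟩ := Metric.eventually_nhds_iff.1 hev
  have hnt : ∀ t : ℝ, IsNontrivialInterval ((fun s : ℝ => (s : T1)) '' Ioo (t - ε) (t + ε)) :=
    fun t => ⟨_, ordConnected_Ioo, (Ioo_infinite (by linarith)).nontrivial, rfl⟩
  -- A crossing gives a point where $c_n$ meets $\Gamma$. There $f^n$ carries a point of `W1` over
  -- $\Gamma$, near the base point from which $f^j$ reaches the part of $c_j$ inside `O`.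
  obtain ⟨n, hn⟩ := hT _ _ (hnt t0) (hnt t1)
  rw [iter_graph hR] at hn
  obtain ⟨θ, ⟨⟨s', hs', hθ⟩, _, ⟨s, hs, rfl⟩, hs''⟩, he⟩ :=
    hn.exists_eq hγ (continuous_curve (ω := ω) (R := R) hγ n)
  simp only at hθ hs''
  subst hθ
  have hss : ((s : T1), y1) ∈ W1 ∧
      ((s' : T1) + j • (ω : T1), curve ω R γ j ((s' : T1) + j • (ω : T1))) ∈ O := by
    refine @hev (s, s') ?_
    rw [← Metric.mem_ball, ← ball_prod_same, Real.ball_eq_Ioo, Real.ball_eq_Ioo]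
    exact ⟨hs, hs'⟩
  have h1 : π ((s : T1), y1) = ((s : T1), curve ω R γ 0 (s : T1)) :=
    Prod.ext (hB.fibre _ _) (hW1g hss.1)
  have h2 : π ((f ^ (n : ℤ)) ((s : T1), y1)) = ((s' : T1), curve ω R γ 0 (s' : T1)) := by
    rw [semiconj_zpow hB.semiconj, h1, zpow_apply_curve hR, add_zero, natCast_zsmul, hs'',
      curve_zero, he]
  have h3 : (f ^ j) ((f ^ (n : ℤ)) ((s : T1), y1)) ∈ U := by
    refine hOU ?_
    rw [mem_preimage, semiconj_zpow hB.semiconj, h2, zpow_apply_curve hR, add_zero]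
    exact hss.2
  rw [← zpow_add_apply] at h3
  refine ⟨U ∩ (fun z => (f ^ (-(j + n))) z) ⁻¹' W1, j + n + 0,
    hU.inter (hW1o.preimage (f ^ (-(j + (n : ℤ)))).continuous),
    ⟨_, h3, ?_⟩, inter_subset_left, ?_⟩
  · rw [mem_preimage, ← zpow_add_apply, neg_add_cancel, zpow_zero]
    exact hss.1
  · rintro z ⟨-, hz⟩
    have := zpow_mem_gapSet hB hR (hW1g hz) (j + n)
    rwa [← zpow_add_apply, add_neg_cancel, zpow_zero] at this

theorem isTransitive_of_isBlowUp (hT : CrossingProperty ω R (graph γ))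
    (hD : Dense (orbitUnion R (graph γ))) : IsTransitive f := by
  intro U V hU hV hUne hVne
  obtain ⟨W1, i, hW1, hW1ne, hW1U, hW1g⟩ :=
    exists_open_subset_gapSet_of_dense hB hR hγ hT hD hU hUne
  obtain ⟨W2, j, hW2, hW2ne, hW2V, hW2g⟩ :=
    exists_open_subset_gapSet_of_dense hB hR hγ hT hD hV hVne
  have hne : ∀ (W : Set T2) (k : ℤ), W.Nonempty → ((fun z => (f ^ k) z) ⁻¹' W).Nonempty :=
    fun W k ⟨w, hw⟩ => ⟨(f ^ k).symm w, by simpa using hw⟩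
  -- Both pieces are pulled back to gaps over $\Gamma$. The lower bound on the time makes $j+n-i$
  -- nonnegative, as a forward iterate requires.
  obtain ⟨n, hn, z, hz1, hz2⟩ := exists_iterate_mem_of_gapSet hB hR hγ hT
    (hW1.preimage (f ^ i).continuous) (hW2.preimage (f ^ j).continuous) (hne _ _ hW1ne)
    (hne _ _ hW2ne) (zpow_preimage_gapSet hB hR hW1g) (zpow_preimage_gapSet hB hR hW2g)
    (i.natAbs + j.natAbs)
  rw [mem_preimage, ← zpow_add_apply] at hz2
  obtain ⟨m, hm⟩ : ∃ m : ℕ, (m : ℤ) = j + n - i := ⟨(j + n - i).toNat, by omega⟩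
  have hit : ∀ w, f^[m] w = (f ^ (m : ℤ)) w := fun w => by
    clear hm
    induction m with
    | zero => simp
    | succ m ih => rw [Function.iterate_succ_apply', ih, Nat.cast_succ, zpow_one_add_apply]
  refine ⟨m, f^[m] ((f ^ i) z), ⟨_, hW1U hz1, rfl⟩, hW2V ?_⟩
  rw [hit, ← zpow_add_apply, hm, sub_add_cancel]
  exact hz2

end transitivity

end QPF

theorem mainTheorem4 (ω : ℝ) (R : QPF.T2 ≃ₜ QPF.T2) (hR : QPF.IsQpf ω R)
    (γ : QPF.T1 → QPF.T1) (hγ : Continuous γ)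
    (hflat : ∀ n : ℤ, QPF.FlatIntersections (QPF.graph γ) (QPF.iter R n (QPF.graph γ))) :
    (∃ (π : QPF.T2 → QPF.T2) (f : QPF.T2 ≃ₜ QPF.T2),
      QPF.IsBlowUp ω R (QPF.orbitUnion R (QPF.graph γ)) π f) ∧
    (QPF.IsTransitive R → QPF.CrossingProperty ω R (QPF.graph γ) →
      Dense (QPF.orbitUnion R (QPF.graph γ)) →
      ∀ (π : QPF.T2 → QPF.T2) (f : QPF.T2 ≃ₜ QPF.T2),
        QPF.IsBlowUp ω R (QPF.orbitUnion R (QPF.graph γ)) π f → QPF.IsTransitive f) :=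
  ⟨QPF.exists_isBlowUp hR hγ hflat,
    fun _ hT hD _ _ hB => QPF.isTransitive_of_isBlowUp hB hR.2.1 hγ hT hD⟩
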